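/- Let $\mathcal{B}$ be a unital complex $*$-algebra with star-linear maps $\phi:\mathcal{B}\to\mathbb{C}$ and $\gamma:\mathcal{B}\to\mathcal{B}$ and a linear map $\Lambda:\mathcal{B}\otimes_{\mathrm{alg}}\mathcal{B}\to\mathcal{B}$ such that $\phi$ is positive and faithful ($\phi[u^*u]=0$ only for $u=0$), $\gamma+\phi$ (that is, $b\mapsto\gamma[b]+\phi[b]1$) is completely positive, and for all $b,u,v\in\mathcal{B}$ $$\phi[v^*\Lambda(b\otimes u)]=\phi[\Lambda(b^*\otimes v)^*u],\qquad \gamma[v^*\Lambda(b\otimes u)]=\gamma[\Lambda(b^*\otimes v)^*u].$$ Here an element of a $*$-algebra is positive if it is a finite sum of elements $u^*u$, a map is positive if it sends each $u^*u$ to a positive element, and completely positive if all its entrywise amplifications to $n\times n$ matrices are positive. On the algebraic Fock space $\mathcal{F}_{alg}(\mathcal{B})=\mathbb{C}\Omega\oplus\bigoplus_{n\ge1}\mathcal{B}^{\otimes n}$ let $\langle\cdot,\cdot\rangle_{\gamma,\phi}$ be the sesquilinear form, linear in the first argument, with $\langle\Omega,\Omega\rangle_{\gamma,\phi}=1$ and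 $$\langle u_1\otimes\cdots\otimes u_n,\,v_1\otimes\cdots\otimes v_k\rangle_{\gamma,\phi}=\delta_{n=k}\,\phi\big[v_n^*(\gamma+\phi)[v_{n-1}^*(\gamma+\phi)[\cdots(\gamma+\phi)[v_1^*u_1]\cdots]u_{n-1}]u_n\big].$$ For $b\in\mathcal{B}$ define operators on $\mathcal{F}_{alg}(\mathcal{B})$ by $a^+(b)(u_1\otimes\cdots\otimes u_n)=b\otimes u_1\otimes\cdots\otimes u_n$; $a^-(b)(u_1\otimes\cdots\otimes u_n)=(\gamma+\phi)[bu_1]u_2\otimes u_3\otimes\cdots\otimes u_n$ for $n\ge2$, $a^-(b)u_1=\phi[bu_1]\Omega$, $a^-(b)\Omega=0$; $a^0(b)(u_1\otimes\cdots\otimes u_n)=\Lambda(b\otimes u_1)\otimes u_2\otimes\cdots\otimes u_n$ for $n\ge1$, $a^0(b)\Omega=0$; $a_\gamma^\sim(b)(u_1\otimes\cdots\otimes u_n)=\gamma[bu_1]u_2\otimes u_3\otimes\cdots\otimes u_n$ for $n\ge2$, and $a_\gamma^\sim(b)=0$ on tensors of length $\le1$. Put $X(b)=a^+(b)+a^-(b)+a^0(b)$.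 Let $R[\,\cdot\,]$ denote the joint free cumulants with respect to the vacuum state $A\mapsto\langle A\Omega,\Omega\rangle_{\gamma,\phi}$; they are defined inductively by the moment-cumulant formula $\langle X_1\cdots X_k\Omega,\Omega\rangle_{\gamma,\phi}=\sum_{\pi\in\mathrm{NC}(k)}\prod_{V\in\pi}R[X_{V(1)},\ldots,X_{V(|V|)}]$, where $V=\{V(1)<\cdots<V(|V|)\}$. For $u_1,\dots,u_k\in\mathcal{B}$ let the operator $R'[u_1,\dots,u_k]$ on $\mathcal{B}$ be defined recursively by $R'[\emptyset]=1$ and $$R'[u_1,\dots,u_k]=\sum_{\pi\in\mathrm{Int}(\{1,\dots,k\})}\ \prod_{V\in\pi}w(V),$$ where $\mathrm{Int}$ denotes interval partitions, the factors are ordered from left to right by the blocks' order of appearance, $w(\{i\})$ is the operator $v\mapsto\Lambda(u_i\otimes v)$, and for $l\ge2$, $w(\{i_1<\dots<i_l\})$ is left multiplication by $\gamma\big[u_{i_1}\,(R'[u_{i_2},\dots,u_{i_{l-1}}]u_{i_l})\big]$. Then for every $n\ge2$ and all $u_1,\dots,u_n\in\mathcal{B}$ $$R[X(u_1),\dots,X(u_n)]=\big\langle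 R'[u_2,\dots,u_{n-1}]u_n,\;u_1^*\big\rangle_{\gamma,\phi}=\phi\big[u_1\,R'[u_2,\dots,u_{n-1}]u_n\big].$$ Moreover, in $\mathcal{B}=\mathcal{B}^{\otimes1}\subset\mathcal{F}_{alg}(\mathcal{B})$, $$u_1\Big(\sum_{\pi\in\mathrm{Int}(\{2,\dots,n-1\})}\ \prod_{V\in\pi}w(V)\Big)u_n=\sum_{\pi\in\widetilde{\mathrm{NC}}_{ns}(n)}W'(\pi)\Omega,$$ where $\widetilde{\mathrm{NC}}_{ns}(n)$ is the set of noncrossing partitions of $\{1,\dots,n\}$ without singleton blocks in which $1$ and $n$ lie in the same block, and $W'(\pi)=a_1(u_1)a_2(u_2)\cdots a_n(u_n)$ with $a_i=a^+$ if $i$ is the last element of its block, $a_i=a_\gamma^\sim$ if $i\ne1$ is the first element of its block, $a_i=a^0$ if $i$ is neither first nor last in its block, and $a_1(u_1)$ acting on $\mathcal{B}^{\otimes 1}$ by $v\mapsto u_1v$. -/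

import Mathlib

open scoped TensorProduct DirectSum

noncomputable section

namespace NNFock

/-! ### Partitions of finite sets of natural numbers -/

/-- `i` and `j` lie in the same block of `π`. -/
def SameBlock {S : Finset ℕ} (π : Finpartition S) (i j : ℕ) : Prop :=
  ∃ V ∈ π.parts, i ∈ V ∧ j ∈ V

/-- `i` is the first element of its block. -/
def IsOpening {S : Finset ℕ} (π : Finpartition S) (i : ℕ) : Prop :=
  ∃ V ∈ π.parts, i ∈ V ∧ ∀ j ∈ V, i ≤ j

/-- `i` is the last element of its block. -/
def IsClosing {S : Finset ℕ} (π : Finpartition S) (i : ℕ) : Prop :=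
  ∃ V ∈ π.parts, i ∈ V ∧ ∀ j ∈ V, j ≤ i

/-- No `i < j < k < l` with `i ∼ k` and `j ∼ l`, unless all four are in the same block. -/
def IsNoncrossing {S : Finset ℕ} (π : Finpartition S) : Prop :=
  ∀ i j k l : ℕ, i < j → j < k → k < l → SameBlock π i k → SameBlock π j l → SameBlock π i j

/-- Whenever `i ∼ j` and `k ∈ S` lies between `i` and `j`, also `i ∼ k`. -/
def IsInterval {S : Finset ℕ} (π : Finpartition S) : Prop :=
  ∀ i j k : ℕ, k ∈ S → i < k → k < j → SameBlock π i j → SameBlock π i k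

open scoped Classical in
/-- `NC(S)`: the noncrossing partitions of `S`. -/
def ncPartitions (S : Finset ℕ) : Finset (Finpartition S) :=
  Finset.univ.filter fun π => IsNoncrossing π

open scoped Classical in
/-- `Int(S)`: the interval partitions of `S`. -/
def intervalPartitions (S : Finset ℕ) : Finset (Finpartition S) :=
  Finset.univ.filter fun π => IsInterval π

open scoped Classical in
/-- The noncrossing partitions of `{1, …, n}` without singleton blocks for which `1 ∼ n`. -/
def ncTildeNs (n : ℕ) : Finset (Finpartition (Finset.Icc 1 n)) :=
  Finset.univ.filter fun π => IsNoncrossing π ∧ SameBlock π 1 n ∧ ∀ V ∈ π.parts, V.card ≠ 1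

/-- The product of `f i`, `i ∈ S`, with the factors in increasing order of `i`. -/
def orderedProd {M : Type*} [Monoid M] (S : Finset ℕ) (f : ℕ → M) : M :=
  ((S.sort (· ≤ ·)).map f).prod

open scoped Classical in
/-- The opening elements of a partition of `S`; they label the blocks, in order of appearance. -/
def openings {S : Finset ℕ} (π : Finpartition S) : Finset ℕ :=
  S.filter fun i => IsOpening π i

/-- The elements of `V` that are neither the first nor the last. -/
def inside (V : Finset ℕ) : Finset ℕ :=
  V.filter fun j => (∃ a ∈ V, a < j) ∧ ∃ b ∈ V, j < b

theorem inside_card_lt {V : Finset ℕ} (hV : V.Nonempty) : (inside V).card < V.card := by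
  apply Finset.card_lt_card
  refine Finset.filter_ssubset.2 ⟨V.min' hV, V.min'_mem hV, ?_⟩
  rintro ⟨⟨a, ha, hlt⟩, -⟩
  exact absurd (V.min'_le a ha) (not_le.2 hlt)

/-! ### Free cumulants -/

/-- The joint free cumulant `R[x_{i_1}, …, x_{i_k}]` with respect to the functional `ψ`, where
`S = {i_1 < ⋯ < i_k}`: the moment minus the contributions of all noncrossing partitions of `S`
other than the one-block partition. -/
def freeCumulant {A : Type*} [Monoid A] (ψ : A → ℂ) (x : ℕ → A) (S : Finset ℕ) : ℂ :=
  ψ (orderedProd S x) -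
    ∑ π ∈ ((ncPartitions S).filter fun π => S ∉ π.parts).attach,
      ∏ V ∈ π.1.parts.attach, freeCumulant ψ x V.1
termination_by S.card
decreasing_by
  have hV := V.2
  have hπ := (Finset.mem_filter.1 π.2).2
  apply Finset.card_lt_card
  refine lt_of_le_of_ne (π.1.le hV) ?_
  intro h
  exact hπ (h.subst (motive := fun W => W ∈ π.1.parts) hV)

/-- The one-block partition is noncrossing. -/
theorem isNoncrossing_of_mem {S : Finset ℕ} (π : Finpartition S) (h : S ∈ π.parts) :
    IsNoncrossing π := by
  rintro i j k l - - - ⟨V, hV, hi, -⟩ ⟨W, hW, hj, -⟩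
  exact ⟨S, h, π.le hV hi, π.le hW hj⟩

/-- The free moment-cumulant formula. -/
theorem moment_eq_sum_freeCumulant {A : Type*} [Monoid A] (ψ : A → ℂ) (x : ℕ → A)
    (S : Finset ℕ) (hS : S.Nonempty) :
    ψ (orderedProd S x) = ∑ π ∈ ncPartitions S, ∏ V ∈ π.parts, freeCumulant ψ x V := by
  classical
  have hne : S ≠ ⊥ := hS.ne_empty
  have key : (ncPartitions S).filter (fun π => S ∈ π.parts) = {Finpartition.indiscrete hne} := by
    ext π
    simp only [Finset.mem_filter, Finset.mem_singleton]
    constructor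
    · rintro ⟨-, h⟩
      ext V
      simp only [Finpartition.indiscrete, Finset.mem_singleton]
      constructor
      · intro hV
        obtain ⟨a, ha⟩ := π.nonempty_of_mem_parts hV
        exact π.eq_of_mem_parts hV h ha (π.le hV ha)
      · rintro rfl
        exact h
    · rintro rfl
      have h : S ∈ (Finpartition.indiscrete hne).parts := by simp [Finpartition.indiscrete]
      exact ⟨by simpa [ncPartitions] using isNoncrossing_of_mem _ h, h⟩
  rw [← Finset.sum_filter_add_sum_filter_not (ncPartitions S) (fun π => S ∈ π.parts), key,
    Finset.sum_singleton]
  have h1 : (Finpartition.indiscrete hne).parts = {S} := rfl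
  rw [h1, Finset.prod_singleton]
  conv_rhs => enter [1]; rw [freeCumulant]
  rw [← Finset.sum_attach ((ncPartitions S).filter fun π => S ∉ π.parts)]
  have h2 : ∀ π : Finpartition S, ∏ V ∈ π.parts.attach, freeCumulant ψ x V.1
      = ∏ V ∈ π.parts, freeCumulant ψ x V := fun π => Finset.prod_attach _ _
  simp only [h2]
  ring

/-! ### Positivity -/

/-- An element of a `*`-algebra is positive if it is a finite sum of elements `u^* u`. -/
def IsPos {C : Type*} [NonUnitalSemiring C] [Star C] (b : C) : Prop :=
  ∃ (k : ℕ) (u : Fin k → C), b = ∑ i, star (u i) * u i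

/-- `T` maps each `u^* u` to a positive element. -/
def IsPosMap {B C : Type*} [NonUnitalSemiring B] [Star B] [NonUnitalSemiring C] [Star C]
    (T : B → C) : Prop :=
  ∀ u : B, IsPos (T (star u * u))

/-- All entrywise amplifications `T_n : M_n(B) → M_n(C)` are positive. -/
def IsCPMap {B C : Type*} [Ring B] [StarRing B] [Ring C] [StarRing C] (T : B → C) : Prop :=
  ∀ n : ℕ, IsPosMap fun A : Matrix (Fin n) (Fin n) B => A.map T

/-- The data of the construction on a unital `*`-algebra `B`: `φ` is a positive faithful
functional, `γ + φ` is completely positive (`φ` being regarded as `B`-valued through the unit),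
and `Λ` satisfies the symmetry conditions with respect to `φ` and `γ`. -/
structure Data (B : Type*) [Ring B] [StarRing B] [Algebra ℂ B] [StarModule ℂ B] where
  φ : B →ₗ[ℂ] ℂ
  γ : B →ₗ[ℂ] B
  Λ : B ⊗[ℂ] B →ₗ[ℂ] B
  φ_star : ∀ b, φ (star b) = star (φ b)
  γ_star : ∀ b, γ (star b) = star (γ b)
  φ_pos : IsPosMap φ
  φ_faithful : ∀ b, φ (star b * b) = 0 → b = 0
  cp : IsCPMap (γ + Algebra.linearMap ℂ B ∘ₗ φ)
  φ_symm : ∀ b u v, φ (star v * Λ (b ⊗ₜ u)) = φ (star (Λ (star b ⊗ₜ v)) * u)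
  γ_symm : ∀ b u v, γ (star v * Λ (b ⊗ₜ u)) = γ (star (Λ (star b ⊗ₜ v)) * u)

/-! ### The algebraic Fock space -/

section Fock

variable (B : Type*) [Ring B] [Algebra ℂ B]

/-- The algebraic Fock space `ℂΩ ⊕ ⨁_{n ≥ 1} B^{⊗ n}`; the summand for `n = 0` is `ℂΩ`. -/
abbrev Fock : Type _ := ⨁ n : ℕ, ⨂[ℂ]^n B

/-- The simple tensor `u_1 ⊗ ⋯ ⊗ u_n`, as a multilinear map into the Fock space. -/
def tens (n : ℕ) : MultilinearMap ℂ (fun _ : Fin n => B) (Fock B) :=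
  (DirectSum.lof ℂ ℕ (fun n => ⨂[ℂ]^n B) n).compMultilinearMap (PiTensorProduct.tprod ℂ)

/-- The vacuum vector, i.e. the empty tensor. -/
def vacuum : Fock B := tens B 0 Fin.elim0

variable {B}

/-- The elements of `B` as tensors of length one. -/
def single (b : B) : Fock B := tens B 1 fun _ => b

/-- Linear extension of a map that is given on simple tensors. -/
def fockLift {M : Type*} [AddCommGroup M] [Module ℂ M]
    (f : ∀ n, MultilinearMap ℂ (fun _ : Fin n => B) M) : Fock B →ₗ[ℂ] M :=
  DirectSum.toModule ℂ ℕ M fun n => PiTensorProduct.lift (f n)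

theorem fockLift_tens {M : Type*} [AddCommGroup M] [Module ℂ M]
    (f : ∀ n, MultilinearMap ℂ (fun _ : Fin n => B) M) (n : ℕ) (u : Fin n → B) :
    fockLift f (tens B n u) = f n u := by
  simp [fockLift, tens, DirectSum.toModule_lof]

theorem fock_ext {M : Type*} [AddCommGroup M] [Module ℂ M] {f g : Fock B →ₗ⋆[ℂ] M}
    (h : ∀ n v, f (tens B n v) = g (tens B n v)) : f = g := by
  ext x
  induction x using DirectSum.induction_on with
  | zero => simp
  | add x y hx hy => simp [hx, hy]
  | of n x =>
    induction x using PiTensorProduct.induction_on with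
    | smul_tprod r v =>
      have := h n v
      have e : DirectSum.of (fun n => ⨂[ℂ]^n B) n (r • PiTensorProduct.tprod ℂ v)
          = r • tens B n v := by
        simp only [tens, LinearMap.compMultilinearMap_apply, ← map_smul]; rfl
      rw [e]; simp [this]
    | add x y hx hy => simp [hx, hy]

/-- `u_1 ⊗ ⋯ ⊗ u_n ↦ b ⊗ u_1 ⊗ ⋯ ⊗ u_n`. -/
def aPlus (b : B) : Module.End ℂ (Fock B) :=
  fockLift fun n => (tens B (n + 1)).curryLeft b

/-- `u_1 ⊗ ⋯ ⊗ u_n ↦ M(u_1) ⊗ u_2 ⊗ ⋯ ⊗ u_n`, and `Ω ↦ 0`. -/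
def firstSlot (M : Module.End ℂ B) : Module.End ℂ (Fock B) :=
  fockLift fun
    | 0 => 0
    | n + 1 => ((tens B (n + 1)).curryLeft ∘ₗ M).uncurryLeft

/-- `u_1 ⊗ ⋯ ⊗ u_n ↦ L[b u_1] u_2 ⊗ u_3 ⊗ ⋯ ⊗ u_n` for `n ≥ 2`, `u_1 ↦ ℓ[b u_1] Ω`, and
`Ω ↦ 0`. -/
def contract (L : B →ₗ[ℂ] B) (ℓ : B →ₗ[ℂ] ℂ) (b : B) : Module.End ℂ (Fock B) :=
  fockLift fun
    | 0 => 0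
    | 1 => ((MultilinearMap.ofSubsingleton ℂ B (Fock B) (0 : Fin 1))
        ((ℓ ∘ₗ LinearMap.mulLeft ℂ b).smulRight (vacuum B)))
    | n + 2 => LinearMap.uncurryLeft
        { toFun := fun x =>
            ((tens B (n + 1)).curryLeft ∘ₗ LinearMap.mulLeft ℂ (L (b * x))).uncurryLeft
          map_add' := fun x y => by
            ext v
            simp [mul_add, add_mul]
          map_smul' := fun c x => by
            ext v
            simp }

theorem aPlus_tens (b : B) (n : ℕ) (u : Fin n → B) :
    aPlus b (tens B n u) = tens B (n + 1) (Fin.cons b u) := by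
  rw [aPlus, fockLift_tens]; rfl

theorem firstSlot_vacuum (M : Module.End ℂ B) : firstSlot M (vacuum B) = 0 := by
  rw [firstSlot, vacuum, fockLift_tens]; rfl

theorem firstSlot_tens (M : Module.End ℂ B) (n : ℕ) (u : Fin (n + 1) → B) :
    firstSlot M (tens B (n + 1) u) = tens B (n + 1) (Fin.cons (M (u 0)) (Fin.tail u)) := by
  rw [firstSlot, fockLift_tens]; rfl

theorem contract_vacuum (L : B →ₗ[ℂ] B) (ℓ : B →ₗ[ℂ] ℂ) (b : B) :
    contract L ℓ b (vacuum B) = 0 := by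
  rw [contract, vacuum, fockLift_tens]; rfl

theorem contract_single (L : B →ₗ[ℂ] B) (ℓ : B →ₗ[ℂ] ℂ) (b u : B) :
    contract L ℓ b (single u) = ℓ (b * u) • vacuum B := by
  rw [contract, single, fockLift_tens]; rfl

theorem contract_tens (L : B →ₗ[ℂ] B) (ℓ : B →ₗ[ℂ] ℂ) (b : B) (n : ℕ) (u : Fin (n + 2) → B) :
    contract L ℓ b (tens B (n + 2) u) =
      tens B (n + 1) (Fin.cons (L (b * u 0) * u 1) (Fin.tail (Fin.tail u))) := by
  rw [contract, fockLift_tens]; rfl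

end Fock

namespace Data

variable {B : Type*} [Ring B] [StarRing B] [Algebra ℂ B] [StarModule ℂ B] (D : Data B)

/-- The map `γ + φ : B → B`. -/
def γφ : B →ₗ[ℂ] B := D.γ + Algebra.linearMap ℂ B ∘ₗ D.φ

/-! ### The inner product -/

/-- `v_n^* (γ + φ)[v_{n-1}^* (γ + φ)[ ⋯ (γ + φ)[v_1^* u_1] ⋯ ] u_{n-1}] u_n`, for tuples of
length `n = m + 1`. -/
def nest : ∀ m : ℕ, (Fin (m + 1) → B) → (Fin (m + 1) → B) → B
  | 0, u, v => star (v 0) * u 0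
  | m + 1, u, v =>
    star (v (Fin.last _)) * D.γφ (nest m (Fin.init u) (Fin.init v)) * u (Fin.last _)

/-- The inner product of two simple tensors of the same length. -/
def ipSimple : ∀ n : ℕ, (Fin n → B) → (Fin n → B) → ℂ
  | 0, _, _ => 1
  | m + 1, u, v => D.φ (D.nest m u v)

theorem nest_left_add (m : ℕ) (u v : Fin (m + 1) → B) (i : Fin (m + 1)) (x y : B) :
    D.nest m (Function.update u i (x + y)) v =
      D.nest m (Function.update u i x) v + D.nest m (Function.update u i y) v := by
  induction m with
  | zero => obtain rfl : i = 0 := Fin.fin_one_eq_zero i; simp [nest, mul_add]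
  | succ m ih =>
    induction i using Fin.lastCases with
    | last => simp [nest, mul_add]
    | cast i => simp [nest, Fin.init_update_castSucc, ih, mul_add, add_mul,
        Function.update_of_ne (Fin.castSucc_lt_last i).ne']

theorem nest_left_smul (m : ℕ) (u v : Fin (m + 1) → B) (i : Fin (m + 1)) (c : ℂ) (x : B) :
    D.nest m (Function.update u i (c • x)) v = c • D.nest m (Function.update u i x) v := by
  induction m with
  | zero => obtain rfl : i = 0 := Fin.fin_one_eq_zero i; simp [nest]
  | succ m ih =>
    induction i using Fin.lastCases with
    | last => simp [nest]
    | cast i => simp [nest, Fin.init_update_castSucc, ih,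
        Function.update_of_ne (Fin.castSucc_lt_last i).ne']

theorem nest_right_add (m : ℕ) (u v : Fin (m + 1) → B) (i : Fin (m + 1)) (x y : B) :
    D.nest m u (Function.update v i (x + y)) =
      D.nest m u (Function.update v i x) + D.nest m u (Function.update v i y) := by
  induction m with
  | zero => obtain rfl : i = 0 := Fin.fin_one_eq_zero i; simp [nest, add_mul]
  | succ m ih =>
    induction i using Fin.lastCases with
    | last => simp [nest, add_mul]
    | cast i => simp [nest, Fin.init_update_castSucc, ih, mul_add, add_mul,
        Function.update_of_ne (Fin.castSucc_lt_last i).ne']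

theorem nest_right_smul (m : ℕ) (u v : Fin (m + 1) → B) (i : Fin (m + 1)) (c : ℂ) (x : B) :
    D.nest m u (Function.update v i (c • x)) = star c • D.nest m u (Function.update v i x) := by
  induction m with
  | zero => obtain rfl : i = 0 := Fin.fin_one_eq_zero i; simp [nest]
  | succ m ih =>
    induction i using Fin.lastCases with
    | last => simp [nest]
    | cast i => simp [nest, Fin.init_update_castSucc, ih,
        Function.update_of_ne (Fin.castSucc_lt_last i).ne']

/-- `v ↦ conj ⟨u, v⟩` on simple tensors of length `n`. -/
def ipConjRight (n : ℕ) (u : Fin n → B) : MultilinearMap ℂ (fun _ : Fin n => B) ℂ where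
  toFun v := star (D.ipSimple n u v)
  map_update_add' {inst} v i x y := by
    obtain rfl := Subsingleton.elim inst (instDecidableEqFin n)
    cases n with
    | zero => exact i.elim0
    | succ m => simp [ipSimple, nest_right_add]
  map_update_smul' {inst} v i c x := by
    obtain rfl := Subsingleton.elim inst (instDecidableEqFin n)
    cases n with
    | zero => exact i.elim0
    | succ m => simp [ipSimple, nest_right_smul]

/-- The conjugate-linear functional `η ↦ ⟨u_1 ⊗ ⋯ ⊗ u_n, η⟩`, which only sees the component of
`η` of length `n`. -/
def ipLeft (n : ℕ) (u : Fin n → B) : Fock B →ₗ⋆[ℂ] ℂ where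
  toFun η := star (PiTensorProduct.lift (D.ipConjRight n u)
    (DirectSum.component ℂ ℕ (fun n => ⨂[ℂ]^n B) n η))
  map_add' η ζ := by simp
  map_smul' c η := by simp

theorem ipLeft_tens (n : ℕ) (u v : Fin n → B) :
    D.ipLeft n u (tens B n v) = D.ipSimple n u v := by
  simp [ipLeft, tens, ipConjRight, DirectSum.component.lof_self]

theorem ipLeft_tens_of_ne {n k : ℕ} (h : n ≠ k) (u : Fin n → B) (v : Fin k → B) :
    D.ipLeft n u (tens B k v) = 0 := by
  simp [ipLeft, tens, DirectSum.component.of, h.symm]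

/-- The inner product `⟨·,·⟩_{γ,φ}`: the sesquilinear extension (linear in the first argument) of
`⟨u_1 ⊗ ⋯ ⊗ u_n, v_1 ⊗ ⋯ ⊗ v_k⟩
  = δ_{n=k} φ[v_n^* (γ + φ)[v_{n-1}^* ⋯ (γ + φ)[v_1^* u_1] ⋯ u_{n-1}] u_n]`. -/
def ip : Fock B →ₗ[ℂ] Fock B →ₗ⋆[ℂ] ℂ :=
  fockLift fun n =>
    { toFun := D.ipLeft n
      map_update_add' := fun {inst} u i x y => by
        obtain rfl := Subsingleton.elim inst (instDecidableEqFin n)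
        refine fock_ext fun k v => ?_
        by_cases h : n = k
        · subst h
          cases n with
          | zero => exact i.elim0
          | succ m => simp [ipLeft_tens, ipSimple, nest_left_add]
        · simp [ipLeft_tens_of_ne D h]
      map_update_smul' := fun {inst} u i c x => by
        obtain rfl := Subsingleton.elim inst (instDecidableEqFin n)
        refine fock_ext fun k v => ?_
        by_cases h : n = k
        · subst h
          cases n with
          | zero => exact i.elim0
          | succ m => simp [ipLeft_tens, ipSimple, nest_left_smul]
        · simp [ipLeft_tens_of_ne D h] }

theorem ip_tens (n : ℕ) (u v : Fin n → B) :
    D.ip (tens B n u) (tens B n v) = D.ipSimple n u v := by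
  rw [ip, fockLift_tens]; exact D.ipLeft_tens n u v

theorem ip_tens_of_ne {n k : ℕ} (h : n ≠ k) (u : Fin n → B) (v : Fin k → B) :
    D.ip (tens B n u) (tens B k v) = 0 := by
  rw [ip, fockLift_tens]; exact D.ipLeft_tens_of_ne h u v

/-! ### The operators -/

/-- The map `v ↦ Λ(b ⊗ v)` on `B`. -/
def ΛOp (b : B) : Module.End ℂ B := D.Λ ∘ₗ TensorProduct.mk ℂ B B b

/-- `a^0(b)` on the Fock space: `u_1 ⊗ ⋯ ⊗ u_n ↦ Λ(b ⊗ u_1) ⊗ u_2 ⊗ ⋯ ⊗ u_n`, `Ω ↦ 0`. -/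
def aZero (b : B) : Module.End ℂ (Fock B) := firstSlot (D.ΛOp b)

/-- `a^-(b)`: `u_1 ⊗ ⋯ ⊗ u_n ↦ (γ + φ)[b u_1] u_2 ⊗ ⋯ ⊗ u_n` for `n ≥ 2`,
`u_1 ↦ φ[b u_1] Ω`, `Ω ↦ 0`. -/
def aMinus (b : B) : Module.End ℂ (Fock B) := contract D.γφ D.φ b

/-- `X(b) = a^+(b) + a^-(b) + a^0(b)`. -/
def X (b : B) : Module.End ℂ (Fock B) := aPlus b + D.aMinus b + D.aZero b

/-- The vacuum state `A ↦ ⟨A Ω, Ω⟩`. -/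
def vacuumState (A : Module.End ℂ (Fock B)) : ℂ := D.ip (A (vacuum B)) (vacuum B)

/-- `a_γ^∼(b)`: `u_1 ⊗ ⋯ ⊗ u_n ↦ γ[b u_1] u_2 ⊗ ⋯ ⊗ u_n` for `n ≥ 2`, and `0` for `n ≤ 1`. -/
def aGamma (b : B) : Module.End ℂ (Fock B) := contract D.γ 0 b

open scoped Classical in
/-- The weight `W'(π) = ∏_{i=1}^n a_i(u_i)`, where `a_i` is `a^+` if `i` is closing, `a_γ^∼` if
`i ≠ 1` is opening, `a^0` if `i` is a middle element, and the opening step at `1` is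
`v ↦ u_1 v`, without applying `φ` to the product. -/
def weightPrime (u : ℕ → B) {n : ℕ} (π : Finpartition (Finset.Icc 1 n)) :
    Module.End ℂ (Fock B) :=
  orderedProd (Finset.Icc 1 n) fun i =>
    if IsClosing π i then aPlus (u i)
    else if i = 1 then firstSlot (LinearMap.mulLeft ℂ (u i))
    else if IsOpening π i then D.aGamma (u i)
    else D.aZero (u i)

/-- The operator `R'[u_{i_1}, …, u_{i_k}]` on `B`, where `S = {i_1 < ⋯ < i_k}`: the sum over the
interval partitions of `S` of the products of the weights of the blocks, in their order of
appearance. A singleton block `{i}` has the weight `v ↦ Λ(u_i ⊗ v)`, and a block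
`V = {j_1 < ⋯ < j_l}` with `l ≥ 2` has as weight the multiplication by
`γ[u_{j_1} R'[u_{j_2}, …, u_{j_{l-1}}] u_{j_l}]`. -/
def Rprime (u : ℕ → B) (S : Finset ℕ) : Module.End ℂ B :=
  ∑ π ∈ intervalPartitions S, orderedProd (openings π) fun i =>
    if h : 2 ≤ (π.part i).card then
      have hne : (π.part i).Nonempty := Finset.card_pos.1 (by omega)
      LinearMap.mulLeft ℂ
        (D.γ (u ((π.part i).min' hne) * Rprime u (inside (π.part i)) (u ((π.part i).max' hne))))
    else D.ΛOp (u i)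
termination_by S.card
decreasing_by
  exact lt_of_lt_of_le (inside_card_lt hne) (Finset.card_le_card (π.part_subset i))

end Data

end NNFock

end

/-!
All sums over partitions are turned into recursions, and the recursions are compared. The tool is
`sum_glue`: if no block meets both of two complementary sets `I` and `J`, a partition of `I ∪ J` is
the same as a partition of `I` and one of `J`. For convex `I` this respects noncrossing partitions.

* Splitting off the first block of an interval partition gives (`Data.Rprime_insert`)
  `R'[x w] = Λ_x R'[w] + ∑ γ[u_x R'[w'] u_z] R'[w'']`, summed over the factorizations
  `w = w' z w''`.

* Let `ρ(V) = φ[u_{j_1} R'[u_{j_2}, …, u_{j_{l-1}}] u_{j_l}]` be the conjectured cumulant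
  (`Data.cumulantValue`), let `N(S)` be the sum over `NC(S)` of the products of the `ρ(V)`
  (`ncSum`), and let `K(S) = ∑_{T ⊆ S} R'[u_T] ∏ N(gaps)`, where the gaps are the
  segments into which `T` cuts `S` (`Data.gapSum`). The block of the first element `x` gives
  `N(x w) = ∑ φ[u_x K(w') u_z] N(w'')`. Together with the recursion for `R'` this yields
  `K(x w) = Λ_x K(w) + ∑ (γ + φ)[u_x K(w') u_z] K(w'')` (`Data.gapSum_empty_insert`): if `x ∉ T`,
  then `x` lies in the first gap, which produces the `φ`-part, and if `x ∈ T`, the recursion for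
  `R'` produces the rest.

* On the Fock space, a product of operators `X(u_i)` acts on `v ⊗ η`, as long as the leg `v` is not
  contracted, by replacing `v` with `K(w) v` and putting further legs on top (`Data.X_stayVec`);
  the recursion for `K` is what this action satisfies. Hence the vacuum moment of `∏ X(u_i)` is
  `N(S)` (`Data.vacuumState_orderedProd_X`), and as the moment-cumulant formula determines the
  cumulants, these are the `ρ(V)` (`Data.freeCumulant_X`).

* For the last identity, the smallest element not yet known to lie in the outer block of a
  noncrossing partition either belongs to the outer block or starts an inner block. These two cases
  are the two terms of the recursion for `R'` (`Data.sum_outerPartitions`).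
-/

noncomputable section

namespace NNFock

/-! ### Lower and upper parts of a finite set -/

/-- The elements of `S` smaller than `z`. -/
def below (S : Finset ℕ) (z : ℕ) : Finset ℕ := S.filter (· < z)

/-- The elements of `S` larger than `z`. -/
def above (S : Finset ℕ) (z : ℕ) : Finset ℕ := S.filter (z < ·)

@[simp] theorem mem_below {S : Finset ℕ} {z i : ℕ} : i ∈ below S z ↔ i ∈ S ∧ i < z := by
  simp [below]

@[simp] theorem mem_above {S : Finset ℕ} {z i : ℕ} : i ∈ above S z ↔ i ∈ S ∧ z < i := by
  simp [above]

theorem below_card_lt {S : Finset ℕ} {z : ℕ} (hz : z ∈ S) : (below S z).card < S.card :=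
  Finset.card_lt_card (Finset.filter_ssubset.2 ⟨z, hz, lt_irrefl z⟩)

theorem above_card_lt {S : Finset ℕ} {z : ℕ} (hz : z ∈ S) : (above S z).card < S.card :=
  Finset.card_lt_card (Finset.filter_ssubset.2 ⟨z, hz, lt_irrefl z⟩)

theorem above_above {S : Finset ℕ} {y z : ℕ} (h : y ≤ z) : above (above S y) z = above S z := by
  ext i; simp only [mem_above]; grind

theorem below_below {S : Finset ℕ} {y z : ℕ} (h : y ≤ z) : below (below S z) y = below S y := by
  ext i; simp only [mem_below]; grind

theorem below_above (S : Finset ℕ) (y z : ℕ) : below (above S y) z = above (below S z) y := by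
  ext i; simp only [mem_below, mem_above]; grind

theorem above_insert_self {S : Finset ℕ} {x : ℕ} (hx : ∀ s ∈ S, x < s) :
    above (insert x S) x = S := by
  ext i; simp only [mem_above, Finset.mem_insert]; grind

theorem below_insert_self {S : Finset ℕ} {x : ℕ} (hx : ∀ s ∈ S, x < s) :
    below (insert x S) x = ∅ := by
  ext i; simp only [mem_below, Finset.mem_insert]; grind

theorem above_insert {S : Finset ℕ} {x z : ℕ} (h : x < z) :
    above (insert x S) z = above S z := by
  ext i; simp only [mem_above, Finset.mem_insert]; grind

theorem below_insert {S : Finset ℕ} {x z : ℕ} (h : x < z) :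
    below (insert x S) z = insert x (below S z) := by
  ext i; simp only [mem_below, Finset.mem_insert]; grind

theorem above_insert_right {S : Finset ℕ} {y z : ℕ} (h : z < y) :
    above (insert y S) z = insert y (above S z) := by
  ext i; simp only [mem_above, Finset.mem_insert]; grind

theorem below_insert_right {S : Finset ℕ} {y z : ℕ} (h : z < y) :
    below (insert y S) z = below S z := by
  ext i; simp only [mem_below, Finset.mem_insert]; grind

/-- Induction on a finite set of natural numbers by removing the smallest element. -/
theorem insert_min_induction {p : Finset ℕ → Prop} (empty : p ∅)
    (insert_min : ∀ x S, (∀ s ∈ S, x < s) → p S → p (insert x S)) (S : Finset ℕ) : p S := by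
  induction S using Finset.induction_on_min with
  | empty => exact empty
  | insert a s h ih => exact insert_min a s h ih

/-- A sum over pairs `z < y` of elements of `S`, in both orders of summation. -/
theorem sum_above_comm {M : Type*} [AddCommMonoid M] (S : Finset ℕ) (f : ℕ → ℕ → M) :
    ∑ z ∈ S, ∑ y ∈ above S z, f z y = ∑ y ∈ S, ∑ z ∈ below S y, f z y := by
  refine Finset.sum_comm' fun x y => ?_
  simp only [mem_above, mem_below]; tauto

/-! ### Ordered products -/

theorem orderedProd_empty {M : Type*} [Monoid M] (f : ℕ → M) : orderedProd ∅ f = 1 := by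
  simp [orderedProd]

theorem orderedProd_insert {M : Type*} [Monoid M] {S : Finset ℕ} {x : ℕ} (hx : ∀ s ∈ S, x < s)
    (f : ℕ → M) : orderedProd (insert x S) f = f x * orderedProd S f := by
  rw [orderedProd, Finset.sort_insert _ (fun b hb => (hx b hb).le) fun h => lt_irrefl x (hx x h)]
  simp [orderedProd]

theorem orderedProd_congr {M : Type*} [Monoid M] {S : Finset ℕ} {f g : ℕ → M}
    (h : ∀ i ∈ S, f i = g i) : orderedProd S f = orderedProd S g := by
  rw [orderedProd, orderedProd]
  congr 1
  exact List.map_congr_left fun i hi => h i ((Finset.mem_sort _).1 hi)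

theorem orderedProd_union {M : Type*} [Monoid M] {S T : Finset ℕ} (h : ∀ s ∈ S, ∀ t ∈ T, s < t)
    (f : ℕ → M) : orderedProd (S ∪ T) f = orderedProd S f * orderedProd T f := by
  induction S using insert_min_induction with
  | empty => simp [orderedProd_empty]
  | insert_min x S hx ih =>
    rw [Finset.insert_union, orderedProd_insert, orderedProd_insert hx, ih, mul_assoc]
    · exact fun s hs => h s (Finset.mem_insert_of_mem hs)
    · intro s hs
      rcases Finset.mem_union.1 hs with hs | hs
      · exact hx s hs
      · exact h x (Finset.mem_insert_self x S) s hs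

/-! ### Blocks of a partition -/

section Blocks

variable {S : Finset ℕ} {π : Finpartition S} {i j k : ℕ}

theorem SameBlock.left_mem (h : SameBlock π i j) : i ∈ S := by
  obtain ⟨V, hV, hi, -⟩ := h
  exact π.le hV hi

theorem SameBlock.symm (h : SameBlock π i j) : SameBlock π j i := by
  obtain ⟨V, hV, hi, hj⟩ := h
  exact ⟨V, hV, hj, hi⟩

theorem SameBlock.right_mem (h : SameBlock π i j) : j ∈ S := h.symm.left_mem

theorem SameBlock.trans (h : SameBlock π i j) (h' : SameBlock π j k) : SameBlock π i k := by
  obtain ⟨V, hV, hi, hj⟩ := h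
  obtain ⟨W, hW, hj', hk⟩ := h'
  obtain rfl := π.eq_of_mem_parts hV hW hj hj'
  exact ⟨V, hV, hi, hk⟩

theorem sameBlock_refl (hi : i ∈ S) : SameBlock π i i := by
  obtain ⟨V, hV, h⟩ := π.exists_mem hi
  exact ⟨V, hV, h, h⟩

theorem mem_part_iff_sameBlock : j ∈ π.part i ↔ SameBlock π i j := by
  rw [Finpartition.mem_part_iff_exists]
  exact ⟨fun ⟨V, hV, h, h'⟩ => ⟨V, hV, h', h⟩, fun ⟨V, hV, h, h'⟩ => ⟨V, hV, h', h⟩⟩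

theorem isClosing_iff : IsClosing π i ↔ i ∈ S ∧ ∀ j, SameBlock π i j → j ≤ i := by
  constructor
  · rintro ⟨V, hV, hi, h⟩
    refine ⟨π.le hV hi, ?_⟩
    rintro j ⟨W, hW, hi', hj⟩
    obtain rfl := π.eq_of_mem_parts hV hW hi hi'
    exact h j hj
  · rintro ⟨hi, h⟩
    obtain ⟨V, hV, hiV⟩ := π.exists_mem hi
    exact ⟨V, hV, hiV, fun j hj => h j ⟨V, hV, hiV, hj⟩⟩

theorem isOpening_iff : IsOpening π i ↔ i ∈ S ∧ ∀ j, SameBlock π i j → i ≤ j := by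
  constructor
  · rintro ⟨V, hV, hi, h⟩
    refine ⟨π.le hV hi, ?_⟩
    rintro j ⟨W, hW, hi', hj⟩
    obtain rfl := π.eq_of_mem_parts hV hW hi hi'
    exact h j hj
  · rintro ⟨hi, h⟩
    obtain ⟨V, hV, hiV⟩ := π.exists_mem hi
    exact ⟨V, hV, hiV, fun j hj => h j ⟨V, hV, hiV, hj⟩⟩

/-- Each element lies in the same block as exactly one closing element. -/
theorem existsUnique_closing (hi : i ∈ S) :
    ∃! z, z ∈ S ∧ SameBlock π i z ∧ IsClosing π z := by
  obtain ⟨V, hV, hiV⟩ := π.exists_mem hi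
  refine ⟨V.max' ⟨i, hiV⟩, ⟨π.le hV (V.max'_mem _), ⟨V, hV, hiV, V.max'_mem _⟩,
    V, hV, V.max'_mem _, fun j hj => V.le_max' j hj⟩, ?_⟩
  rintro y ⟨-, ⟨W, hW, hiW, hy⟩, W', hW', hy', hmax⟩
  obtain rfl := π.eq_of_mem_parts hV hW hiV hiW
  obtain rfl := π.eq_of_mem_parts hV hW' hy hy'
  exact le_antisymm (V.le_max' y hy) (hmax _ (V.max'_mem _))

theorem mem_parts_iff_of_sameBlock {P : Finset ℕ} (hi : i ∈ P) :
    P ∈ π.parts ↔ i ∈ S ∧ ∀ j, SameBlock π i j ↔ j ∈ P := by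
  constructor
  · intro hP
    refine ⟨π.le hP hi, fun j => ⟨?_, fun hj => ⟨P, hP, hi, hj⟩⟩⟩
    rintro ⟨W, hW, hiW, hj⟩
    obtain rfl := π.eq_of_mem_parts hP hW hi hiW
    exact hj
  · rintro ⟨hiS, h⟩
    have : P = π.part i := by
      ext j
      rw [mem_part_iff_sameBlock, h]
    rw [this]
    exact π.part_mem.2 hiS

/-- A partition of `S` that has `S` as a block has no other block. -/
theorem eq_indiscrete_of_mem {S : Finset ℕ} (hne : S ≠ ⊥) {π : Finpartition S}
    (h : S ∈ π.parts) : π = Finpartition.indiscrete hne := by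
  ext V
  rw [show (Finpartition.indiscrete hne).parts = {S} from rfl, Finset.mem_singleton]
  constructor
  · intro hV
    obtain ⟨a, ha⟩ := π.nonempty_of_mem_parts hV
    exact π.eq_of_mem_parts hV h ha (π.le hV ha)
  · rintro rfl
    exact h

end Blocks

/-! ### Gluing partitions of complementary sets -/

/-- The partition of `T = I ∪ J` whose blocks are those of `σ` and those of `τ`. -/
def glue {I J T : Finset ℕ} (hd : Disjoint I J) (hT : I ∪ J = T) (σ : Finpartition I)
    (τ : Finpartition J) : Finpartition T where
  parts := σ.parts ∪ τ.parts
  supIndep := by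
    rw [Finset.supIndep_iff_pairwiseDisjoint, Finset.coe_union, Set.pairwiseDisjoint_union]
    exact ⟨σ.disjoint, τ.disjoint, fun V hV W hW _ => hd.mono (σ.le hV) (τ.le hW)⟩
  sup_parts := by
    rw [Finset.sup_union, σ.sup_parts, τ.sup_parts]
    exact hT
  bot_notMem := by
    rw [Finset.mem_union, not_or]
    exact ⟨σ.bot_notMem, τ.bot_notMem⟩

section Glue

variable {I J T : Finset ℕ} (hd : Disjoint I J) (hT : I ∪ J = T) (σ : Finpartition I)
  (τ : Finpartition J)

theorem glue_parts : (glue hd hT σ τ).parts = σ.parts ∪ τ.parts := rfl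

theorem prod_glue {M : Type*} [CommMonoid M] (f : Finset ℕ → M) :
    ∏ V ∈ (glue hd hT σ τ).parts, f V = (∏ V ∈ σ.parts, f V) * ∏ V ∈ τ.parts, f V := by
  refine Finset.prod_union (Finset.disjoint_left.2 fun V hV hV' => ?_)
  obtain ⟨i, hi⟩ := σ.nonempty_of_mem_parts hV
  exact Finset.disjoint_left.1 hd (σ.le hV hi) (τ.le hV' hi)

theorem sameBlock_glue (i j : ℕ) :
    SameBlock (glue hd hT σ τ) i j ↔ SameBlock σ i j ∨ SameBlock τ i j := by
  simp only [SameBlock, glue_parts, Finset.mem_union, or_and_right, exists_or]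

theorem isOpening_glue (i : ℕ) :
    IsOpening (glue hd hT σ τ) i ↔ IsOpening σ i ∨ IsOpening τ i := by
  simp only [IsOpening, glue_parts, Finset.mem_union, or_and_right, exists_or]

theorem isClosing_glue (i : ℕ) :
    IsClosing (glue hd hT σ τ) i ↔ IsClosing σ i ∨ IsClosing τ i := by
  simp only [IsClosing, glue_parts, Finset.mem_union, or_and_right, exists_or]

theorem sameBlock_glue_left {i : ℕ} (hi : i ∈ I) (j : ℕ) :
    SameBlock (glue hd hT σ τ) i j ↔ SameBlock σ i j := by
  rw [sameBlock_glue]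
  exact or_iff_left fun h => Finset.disjoint_left.1 hd hi h.left_mem

theorem sameBlock_glue_right {i : ℕ} (hi : i ∈ J) (j : ℕ) :
    SameBlock (glue hd hT σ τ) i j ↔ SameBlock τ i j := by
  rw [sameBlock_glue]
  exact or_iff_right fun h => Finset.disjoint_left.1 hd h.left_mem hi

/-- If `I` is convex in `T = I ∪ J`, gluing partitions of `I` and `J` creates no crossings. -/
theorem isNoncrossing_glue
    (hI : ∀ i ∈ I, ∀ k ∈ I, ∀ j ∈ J, i < j → j < k → False) :
    IsNoncrossing (glue hd hT σ τ) ↔ IsNoncrossing σ ∧ IsNoncrossing τ := by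
  constructor
  · intro h
    constructor
    · intro i j k l hij hjk hkl h1 h2
      rw [← sameBlock_glue_left hd hT σ τ h1.left_mem]
      exact h i j k l hij hjk hkl ((sameBlock_glue hd hT σ τ _ _).2 (.inl h1))
        ((sameBlock_glue hd hT σ τ _ _).2 (.inl h2))
    · intro i j k l hij hjk hkl h1 h2
      rw [← sameBlock_glue_right hd hT σ τ h1.left_mem]
      exact h i j k l hij hjk hkl ((sameBlock_glue hd hT σ τ _ _).2 (.inr h1))
        ((sameBlock_glue hd hT σ τ _ _).2 (.inr h2))
  · rintro ⟨hσ, hτ⟩ i j k l hij hjk hkl h1 h2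
    rw [sameBlock_glue] at h1 h2 ⊢
    rcases h1 with h1 | h1 <;> rcases h2 with h2 | h2
    · exact .inl (hσ i j k l hij hjk hkl h1 h2)
    · exact (hI i h1.left_mem k h1.right_mem j h2.left_mem hij hjk).elim
    · exact (hI j h2.left_mem l h2.right_mem k h1.right_mem hjk hkl).elim
    · exact .inr (hτ i j k l hij hjk hkl h1 h2)

/-- If `I` is an initial segment of `T = I ∪ J`, gluing preserves interval partitions. -/
theorem isInterval_glue (hI : ∀ i ∈ I, ∀ j ∈ J, i < j) :
    IsInterval (glue hd hT σ τ) ↔ IsInterval σ ∧ IsInterval τ := by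
  constructor
  · intro h
    constructor
    · intro i j k hk hik hkj hij
      rw [← sameBlock_glue_left hd hT σ τ hij.left_mem]
      exact h i j k (hT ▸ Finset.mem_union_left _ hk) hik hkj
        ((sameBlock_glue hd hT σ τ _ _).2 (.inl hij))
    · intro i j k hk hik hkj hij
      rw [← sameBlock_glue_right hd hT σ τ hij.left_mem]
      exact h i j k (hT ▸ Finset.mem_union_right _ hk) hik hkj
        ((sameBlock_glue hd hT σ τ _ _).2 (.inr hij))
  · rintro ⟨hσ, hτ⟩ i j k hk hik hkj hij
    rw [sameBlock_glue] at hij ⊢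
    rw [← hT, Finset.mem_union] at hk
    rcases hij with hij | hij <;> rcases hk with hk | hk
    · exact .inl (hσ i j k hk hik hkj hij)
    · exact absurd (hI j hij.right_mem k hk) (by omega)
    · exact absurd (hI k hk i hij.left_mem) (by omega)
    · exact .inr (hτ i j k hk hik hkj hij)

theorem glue_injective {σ σ' : Finpartition I} {τ τ' : Finpartition J}
    (h : glue hd hT σ τ = glue hd hT σ' τ') : σ = σ' ∧ τ = τ' := by
  classical
  have hl : ∀ (σ : Finpartition I) (τ : Finpartition J),
      (glue hd hT σ τ).parts.filter (· ⊆ I) = σ.parts := by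
    intro σ τ
    ext V
    simp only [glue_parts, Finset.mem_filter, Finset.mem_union]
    refine ⟨?_, fun hV => ⟨.inl hV, σ.le hV⟩⟩
    rintro ⟨hV | hV, hVI⟩
    · exact hV
    · obtain ⟨i, hi⟩ := τ.nonempty_of_mem_parts hV
      exact (Finset.disjoint_left.1 hd (hVI hi) (τ.le hV hi)).elim
  have hr : ∀ (σ : Finpartition I) (τ : Finpartition J),
      (glue hd hT σ τ).parts.filter (· ⊆ J) = τ.parts := by
    intro σ τ
    ext V
    simp only [glue_parts, Finset.mem_filter, Finset.mem_union]
    refine ⟨?_, fun hV => ⟨.inr hV, τ.le hV⟩⟩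
    rintro ⟨hV | hV, hVJ⟩
    · obtain ⟨i, hi⟩ := σ.nonempty_of_mem_parts hV
      exact (Finset.disjoint_left.1 hd (σ.le hV hi) (hVJ hi)).elim
    · exact hV
  constructor
  · ext V
    rw [← hl σ τ, h, hl]
  · ext V
    rw [← hr σ τ, h, hr]

/-- A partition of `I ∪ J` with no block meeting both `I` and `J` is glued from partitions of `I`
and `J`. -/
theorem exists_glue (π : Finpartition T) (h : ∀ i ∈ I, ∀ j ∈ J, ¬SameBlock π i j) :
    ∃ σ τ, glue hd hT σ τ = π := by
  have hI : I ≤ T := hT ▸ Finset.subset_union_left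
  have hJ : J ≤ T := hT ▸ Finset.subset_union_right
  refine ⟨π.restrict hI, π.restrict hJ, ?_⟩
  have hcase : ∀ V ∈ π.parts, V ⊆ I ∨ V ⊆ J := by
    intro V hV
    obtain ⟨i, hi⟩ := π.nonempty_of_mem_parts hV
    have hmem : ∀ k ∈ V, k ∈ I ∨ k ∈ J := fun k hk => by
      have := π.le hV hk
      rwa [← hT, Finset.mem_union] at this
    rcases hmem i hi with hiI | hiJ
    · exact .inl fun k hk => (hmem k hk).resolve_right fun hkJ => h i hiI k hkJ ⟨V, hV, hi, hk⟩
    · exact .inr fun k hk => (hmem k hk).resolve_left fun hkI => h k hkI i hiJ ⟨V, hV, hk, hi⟩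
  have key : ∀ W : Finset ℕ, ∀ hW : W ≤ T, (∀ V ∈ π.parts, V ⊆ W ∨ Disjoint V W) →
      ∀ V, V ∈ (π.restrict hW).parts ↔ V ∈ π.parts ∧ V ⊆ W := by
    intro W hW hsat V
    simp only [Finpartition.restrict, Finset.mem_erase, Finset.mem_image]
    constructor
    · rintro ⟨hne, U, hU, rfl⟩
      rcases hsat U hU with h' | h'
      · have : U ⊓ W = U := inf_eq_left.2 h'
        rw [this]
        exact ⟨hU, h'⟩
      · exact (hne (disjoint_iff.1 h')).elim
    · rintro ⟨hV, hVW⟩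
      exact ⟨π.ne_bot hV, V, hV, inf_eq_left.2 hVW⟩
  ext V
  rw [glue_parts, Finset.mem_union,
    key I hI fun V hV => (hcase V hV).imp id fun h' => Finset.disjoint_left.2 fun a ha ha' =>
      Finset.disjoint_left.1 hd ha' (h' ha),
    key J hJ fun V hV => (hcase V hV).symm.imp id fun h' => Finset.disjoint_left.2 fun a ha ha' =>
      Finset.disjoint_left.1 hd (h' ha) ha', ← and_or_left]
  exact ⟨fun h' => h'.1, fun hV => ⟨hV, hcase V hV⟩⟩

/-- A sum over partitions of `I ∪ J` without blocks meeting both `I` and `J` is a double sum over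
the partitions of `I` and those of `J`. -/
theorem sum_glue {M : Type*} [AddCommMonoid M] {A : Finset (Finpartition T)}
    {A₁ : Finset (Finpartition I)} {A₂ : Finset (Finpartition J)}
    (hsat : ∀ π ∈ A, ∀ i ∈ I, ∀ j ∈ J, ¬SameBlock π i j)
    (hmem : ∀ σ τ, glue hd hT σ τ ∈ A ↔ σ ∈ A₁ ∧ τ ∈ A₂) (F : Finpartition T → M) :
    ∑ π ∈ A, F π = ∑ σ ∈ A₁, ∑ τ ∈ A₂, F (glue hd hT σ τ) := by
  rw [← Finset.sum_product']
  symm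
  refine Finset.sum_bij (fun p _ => glue hd hT p.1 p.2) ?_ ?_ ?_ fun _ _ => rfl
  · intro p hp
    exact (hmem _ _).2 (Finset.mem_product.1 hp)
  · intro p _ q _ h
    exact Prod.ext_iff.2 (glue_injective hd hT h)
  · intro π hπ
    obtain ⟨σ, τ, rfl⟩ := exists_glue hd hT π (hsat π hπ)
    exact ⟨(σ, τ), Finset.mem_product.2 ((hmem _ _).1 hπ), rfl⟩

end Glue

/-- Splitting a sum according to the unique `z ∈ S` with a given property. -/
theorem sum_eq_sum_fiber {ι M : Type*} [AddCommMonoid M] (A : Finset ι) (S : Finset ℕ)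
    (p : ι → ℕ → Prop) [∀ z, DecidablePred (p · z)] (h : ∀ a ∈ A, ∃! z, z ∈ S ∧ p a z) (F : ι → M) :
    ∑ a ∈ A, F a = ∑ z ∈ S, ∑ a ∈ A.filter (p · z), F a := by
  simp only [Finset.sum_filter]
  rw [Finset.sum_comm]
  refine Finset.sum_congr rfl fun a ha => ?_
  obtain ⟨z, ⟨hz, hpz⟩, huniq⟩ := h a ha
  rw [Finset.sum_eq_single_of_mem z hz, if_pos hpz]
  intro y hy hne
  exact if_neg fun hpy => hne (huniq y ⟨hy, hpy⟩)

theorem mem_ncPartitions {S : Finset ℕ} {π : Finpartition S} :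
    π ∈ ncPartitions S ↔ IsNoncrossing π := by
  simp [ncPartitions]

theorem mem_intervalPartitions {S : Finset ℕ} {π : Finpartition S} :
    π ∈ intervalPartitions S ↔ IsInterval π := by
  simp [intervalPartitions]

/-! ### Interval partitions -/

theorem inside_eq {P : Finset ℕ} {m z : ℕ} (hmz : m < z) (hP : ∀ p ∈ P, m < p ∧ p < z) :
    inside (insert m (insert z P)) = P := by
  ext j
  simp only [inside, Finset.mem_filter, Finset.mem_insert]
  constructor
  · rintro ⟨rfl | rfl | h, ⟨a, ha, haj⟩, b, hb, hjb⟩ <;> grind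
  · intro h
    have := hP j h
    exact ⟨by tauto, ⟨m, by tauto, this.1⟩, z, by tauto, this.2⟩

theorem min'_eq {P : Finset ℕ} {m z : ℕ} (hmz : m < z) (hP : ∀ p ∈ P, m < p ∧ p < z)
    (hne : (insert m (insert z P)).Nonempty) : (insert m (insert z P)).min' hne = m := by
  refine le_antisymm (Finset.min'_le _ _ (by simp)) (Finset.le_min' _ _ _ ?_)
  simp only [Finset.mem_insert]
  rintro y (rfl | rfl | h)
  exacts [le_rfl, hmz.le, (hP y h).1.le]

theorem max'_eq {P : Finset ℕ} {m z : ℕ} (hmz : m < z) (hP : ∀ p ∈ P, m < p ∧ p < z)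
    (hne : (insert m (insert z P)).Nonempty) : (insert m (insert z P)).max' hne = z := by
  refine le_antisymm (Finset.max'_le _ _ _ ?_) (Finset.le_max' _ _ (by simp))
  simp only [Finset.mem_insert]
  rintro y (rfl | rfl | h)
  exacts [hmz.le, le_rfl, (hP y h).2.le]

theorem mem_openings {S : Finset ℕ} {π : Finpartition S} {i : ℕ} :
    i ∈ openings π ↔ i ∈ S ∧ IsOpening π i := by
  simp [openings]

/-- A sum over the interval partitions of `T`, where `I` is a nonempty initial segment of `T` that
is required to be a block. -/
theorem sum_intervalPartitions_block {I J T : Finset ℕ} (hd : Disjoint I J) (hT : I ∪ J = T)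
    (hne : I ≠ ⊥) (hI : ∀ i ∈ I, ∀ j ∈ J, i < j) {M : Type*} [AddCommMonoid M]
    {A : Finset (Finpartition T)} (hA : ∀ π, π ∈ A ↔ IsInterval π ∧ I ∈ π.parts)
    (F : Finpartition T → M) :
    ∑ π ∈ A, F π
      = ∑ τ ∈ intervalPartitions J, F (glue hd hT (Finpartition.indiscrete hne) τ) := by
  have hpart : (Finpartition.indiscrete hne).parts = {I} := rfl
  rw [sum_glue hd hT (A₁ := {Finpartition.indiscrete hne}) (A₂ := intervalPartitions J),
    Finset.sum_singleton]
  · rintro π hπ i hi j hj hij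
    obtain ⟨V, hV, hiV, hjV⟩ := hij
    obtain rfl := π.eq_of_mem_parts hV ((hA π).1 hπ).2 hiV hi
    exact Finset.disjoint_left.1 hd hjV hj
  · intro σ τ
    rw [hA, isInterval_glue hd hT σ τ hI, Finset.mem_singleton, mem_intervalPartitions,
      glue_parts, Finset.mem_union]
    constructor
    · rintro ⟨⟨-, hτ⟩, h⟩
      have hIσ : I ∈ σ.parts := h.resolve_right fun h' => by
        obtain ⟨i, hi⟩ := τ.nonempty_of_mem_parts h'
        exact Finset.disjoint_left.1 hd hi (τ.le h' hi)
      exact ⟨eq_indiscrete_of_mem hne hIσ, hτ⟩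
    · rintro ⟨rfl, hτ⟩
      refine ⟨⟨?_, hτ⟩, .inl (by rw [hpart]; exact Finset.mem_singleton_self I)⟩
      intro i j k hk _ _ hij
      exact ⟨I, by rw [hpart]; exact Finset.mem_singleton_self I, hij.left_mem, hk⟩

namespace Data

variable {B : Type*} [Ring B] [StarRing B] [Algebra ℂ B] [StarModule ℂ B] (D : Data B)

/-- The weight of the block `V` in the definition of `R'`: the multiplication by
`γ[u_{j_1} R'[u_{j_2}, …, u_{j_{l-1}}] u_{j_l}]` for a block `{j_1 < ⋯ < j_l}` with `l ≥ 2`, and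
`v ↦ Λ(u_i ⊗ v)` for a singleton, whose element `i` has to be supplied. -/
def blockWeight (u : ℕ → B) (i : ℕ) (V : Finset ℕ) : Module.End ℂ B :=
  if h : 2 ≤ V.card then
    have hne : V.Nonempty := Finset.card_pos.1 (by omega)
    LinearMap.mulLeft ℂ (D.γ (u (V.min' hne) * D.Rprime u (inside V) (u (V.max' hne))))
  else D.ΛOp (u i)

theorem Rprime_eq (u : ℕ → B) (S : Finset ℕ) :
    D.Rprime u S = ∑ π ∈ intervalPartitions S,
      orderedProd (openings π) fun i => D.blockWeight u i (π.part i) := by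
  rw [Rprime]; rfl

theorem blockWeight_singleton (u : ℕ → B) (i j : ℕ) :
    D.blockWeight u i {j} = D.ΛOp (u i) := by
  simp [blockWeight]

theorem blockWeight_insert (u : ℕ → B) (i : ℕ) {P : Finset ℕ} {m z : ℕ} (hmz : m < z)
    (hP : ∀ p ∈ P, m < p ∧ p < z) :
    D.blockWeight u i (insert m (insert z P))
      = LinearMap.mulLeft ℂ (D.γ (u m * D.Rprime u P (u z))) := by
  have hcard : 2 ≤ (insert m (insert z P)).card := by
    rw [← Finset.card_pair hmz.ne]
    exact Finset.card_le_card (by grind)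
  rw [blockWeight, dif_pos hcard]
  simp only [inside_eq hmz hP, min'_eq hmz hP, max'_eq hmz hP]

theorem Rprime_empty (u : ℕ → B) : D.Rprime u ∅ = 1 := by
  rw [Rprime_eq]
  have h1 : ∀ π : Finpartition (∅ : Finset ℕ), IsInterval π :=
    fun π i j k hk => absurd hk (Finset.notMem_empty k)
  have h2 : intervalPartitions ∅ = Finset.univ := by
    ext π; simpa [mem_intervalPartitions] using h1 π
  have h3 : ∀ π : Finpartition (∅ : Finset ℕ), openings π = ∅ := fun π => by simp [openings]
  have : Unique (Finpartition (∅ : Finset ℕ)) := inferInstanceAs (Unique (Finpartition ⊥))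
  rw [h2, Fintype.sum_unique, h3, orderedProd_empty]

/-- The contribution to `R'` of the interval partitions having the initial segment `I` as a
block. -/
theorem sum_interval_initial_block (u : ℕ → B) {I J T : Finset ℕ} {m : ℕ} (hd : Disjoint I J)
    (hT : I ∪ J = T) (hm : m ∈ I) (hmin : ∀ i ∈ I, m ≤ i) (hI : ∀ i ∈ I, ∀ j ∈ J, i < j)
    {A : Finset (Finpartition T)} (hA : ∀ π, π ∈ A ↔ IsInterval π ∧ I ∈ π.parts) :
    ∑ π ∈ A, orderedProd (openings π) (fun i => D.blockWeight u i (π.part i))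
      = D.blockWeight u m I * D.Rprime u J := by
  have hne : I ≠ ⊥ := Finset.ne_empty_of_mem hm
  have hpart : (Finpartition.indiscrete hne).parts = {I} := rfl
  rw [sum_intervalPartitions_block hd hT hne hI hA, Rprime_eq, Finset.mul_sum]
  refine Finset.sum_congr rfl fun τ _ => ?_
  have hop : openings (glue hd hT (Finpartition.indiscrete hne) τ) = insert m (openings τ) := by
    ext i
    simp only [mem_openings, Finset.mem_insert, isOpening_glue]
    constructor
    · rintro ⟨hi, ⟨V, hV, hiV, h⟩ | h⟩
      · rw [hpart, Finset.mem_singleton] at hV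
        subst hV
        exact .inl (le_antisymm (h m hm) (hmin i hiV))
      · exact .inr ⟨(isOpening_iff.1 h).1, h⟩
    · rintro (rfl | ⟨hi, h⟩)
      · refine ⟨hT ▸ Finset.mem_union_left _ hm, .inl ⟨I, ?_, hm, hmin⟩⟩
        rw [hpart]; exact Finset.mem_singleton_self I
      · exact ⟨hT ▸ Finset.mem_union_right _ hi, .inr h⟩
  have hsub : openings τ ⊆ J := fun i hi => (mem_openings.1 hi).1
  have hlt : ∀ s ∈ openings τ, m < s := fun s hs => hI m hm s (hsub hs)
  rw [hop, orderedProd_insert hlt]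
  congr 1
  · rw [Finpartition.part_eq_of_mem _ _ hm]
    rw [glue_parts, hpart]
    exact Finset.mem_union_left _ (Finset.mem_singleton_self I)
  · refine orderedProd_congr fun i hi => ?_
    congr 1
    have hiJ : i ∈ J := hsub hi
    refine Finpartition.part_eq_of_mem _ ?_ (τ.mem_part_self.2 hiJ)
    exact Finset.mem_union_right _ (τ.part_mem.2 hiJ)

/-- The recursion for `R'` obtained by splitting off the first block: it is a singleton, or it ends
at some `z > x`. -/
theorem Rprime_insert (u : ℕ → B) {x : ℕ} {S : Finset ℕ} (hx : ∀ s ∈ S, x < s) :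
    D.Rprime u (insert x S) = D.ΛOp (u x) * D.Rprime u S
      + ∑ z ∈ S, LinearMap.mulLeft ℂ (D.γ (u x * D.Rprime u (below S z) (u z)))
          * D.Rprime u (above S z) := by
  classical
  have hxS : x ∉ S := fun h => lt_irrefl x (hx x h)
  rw [Rprime_eq, sum_eq_sum_fiber _ (insert x S) (fun π z => SameBlock π x z ∧ IsClosing π z)
    fun π _ => existsUnique_closing (Finset.mem_insert_self x S), Finset.sum_insert hxS]
  -- The block of `x` in an interval partition is the segment from `x` to its last element.
  have key : ∀ I : Finset ℕ, ∀ z ∈ I, x ∈ I → (∀ i, i ∈ I ↔ i ∈ insert x S ∧ i ≤ z) →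
      ∀ π : Finpartition (insert x S),
        (IsInterval π ∧ SameBlock π x z ∧ IsClosing π z) ↔ IsInterval π ∧ I ∈ π.parts := by
    intro I z hz hxI hI π
    rw [mem_parts_iff_of_sameBlock hxI, isClosing_iff]
    refine and_congr_right fun hπ => ?_
    constructor
    · rintro ⟨hxz, -, hmax⟩
      refine ⟨Finset.mem_insert_self x S, fun j => ?_⟩
      rw [hI]
      refine ⟨fun h => ⟨h.right_mem, hmax j (hxz.symm.trans h)⟩, fun ⟨hj, hjz⟩ => ?_⟩
      rcases Finset.mem_insert.1 hj with rfl | hjS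
      · exact sameBlock_refl hj
      · rcases hjz.lt_or_eq with h | rfl
        · exact hπ x z j hj (hx j hjS) h hxz
        · exact hxz
    · rintro ⟨-, h⟩
      have hxz := (h z).2 hz
      exact ⟨hxz, hxz.right_mem, fun j hj => ((hI j).1 ((h j).1 (hxz.trans hj))).2⟩
  congr 1
  · rw [D.sum_interval_initial_block u (I := {x}) (J := S) (m := x)
      (Finset.disjoint_singleton_left.2 hxS) (Finset.insert_eq x S).symm
      (Finset.mem_singleton_self x) (by simp) (by simpa using hx)
      (fun π => by
        rw [Finset.mem_filter, mem_intervalPartitions]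
        refine key {x} x (by simp) (by simp) (fun i => ?_) π
        simp only [Finset.mem_singleton, Finset.mem_insert]
        grind),
      blockWeight_singleton]
  · refine Finset.sum_congr rfl fun z hz => ?_
    have hxz := hx z hz
    have hmem : ∀ i, i ∈ insert x (insert z (below S z)) ↔ i ∈ insert x S ∧ i ≤ z := by
      intro i
      simp only [Finset.mem_insert, mem_below]
      grind
    rw [D.sum_interval_initial_block u (I := insert x (insert z (below S z))) (J := above S z)
      (m := x) ?_ ?_ (Finset.mem_insert_self _ _) ?_ ?_
      (fun π => by
        rw [Finset.mem_filter, mem_intervalPartitions]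
        exact key _ z (by simp) (by simp) hmem π), blockWeight_insert D u x hxz]
    · intro p hp
      rw [mem_below] at hp
      exact ⟨hx p hp.1, hp.2⟩
    · refine Finset.disjoint_left.2 fun i hi hi' => ?_
      rw [hmem] at hi
      rw [mem_above] at hi'
      omega
    · ext i
      rw [Finset.mem_union, hmem, mem_above, Finset.mem_insert]
      grind
    · intro i hi
      rcases Finset.mem_insert.1 ((hmem i).1 hi).1 with rfl | h
      exacts [le_rfl, (hx i h).le]
    · intro i hi j hj
      rw [hmem] at hi
      rw [mem_above] at hj
      omega

end Data

/-! ### Multiplicative sums over noncrossing partitions -/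

section NCSum

variable {R : Type*} [CommSemiring R] (f : Finset ℕ → R)

/-- The sum over the noncrossing partitions of `S` of the products of the weights of the
blocks. -/
def ncSum (S : Finset ℕ) : R := ∑ π ∈ ncPartitions S, ∏ V ∈ π.parts, f V

open scoped Classical in
/-- The part of `ncSum f (P ∪ S)` that comes from the partitions for which `P` is contained in one
block. -/
def ncSumBlock (P S : Finset ℕ) : R :=
  ∑ π ∈ (ncPartitions (P ∪ S)).filter (fun π => ∀ i ∈ P, ∀ j ∈ P, SameBlock π i j),
    ∏ V ∈ π.parts, f V

theorem ncSum_empty : ncSum f ∅ = 1 := by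
  have h1 : ∀ π : Finpartition (∅ : Finset ℕ), IsNoncrossing π :=
    fun π i j k l _ _ _ h _ => absurd h.left_mem (Finset.notMem_empty i)
  have h2 : ncPartitions ∅ = Finset.univ := by
    ext π; simpa [mem_ncPartitions] using h1 π
  have : Unique (Finpartition (∅ : Finset ℕ)) := inferInstanceAs (Unique (Finpartition ⊥))
  rw [ncSum, h2, Fintype.sum_unique, Finset.prod_eq_one]
  intro V hV
  obtain ⟨i, hi⟩ := Finpartition.nonempty_of_mem_parts _ hV
  exact absurd (Finpartition.le _ hV hi) (Finset.notMem_empty i)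

theorem ncSum_insert (m : ℕ) (S : Finset ℕ) : ncSum f (insert m S) = ncSumBlock f {m} S := by
  classical
  rw [ncSum, ncSumBlock, Finset.insert_eq, Finset.filter_true_of_mem]
  intro π _ i hi j hj
  rw [Finset.mem_singleton] at hi hj
  subst hi hj
  exact sameBlock_refl (by simp)

/-- The noncrossing partitions in which a given initial segment `P` is contained in one block,
sorted by the element `z` that follows `P` in its block, if there is one: the gap between `P` and
`z` is partitioned independently. -/
theorem ncSumBlock_eq {P S : Finset ℕ} (hP : P.Nonempty) (hPS : ∀ p ∈ P, ∀ s ∈ S, p < s) :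
    ncSumBlock f P S = f P * ncSum f S
      + ∑ z ∈ S, ncSum f (below S z) * ncSumBlock f (insert z P) (above S z) := by
  classical
  obtain ⟨p, hp⟩ := hP
  have hd : Disjoint P S := Finset.disjoint_left.2 fun i hi hi' => lt_irrefl i (hPS i hi i hi')
  rw [ncSumBlock,
    ← Finset.sum_filter_add_sum_filter_not _ (fun π => ∀ z ∈ S, ¬SameBlock π p z)]
  congr 1
  -- `P` is a block.
  · have hne : P ≠ ⊥ := Finset.ne_empty_of_mem hp
    have hpart : (Finpartition.indiscrete hne).parts = {P} := rfl
    rw [sum_glue hd rfl (A₁ := {Finpartition.indiscrete hne}) (A₂ := ncPartitions S),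
      Finset.sum_singleton, ncSum, Finset.mul_sum]
    · refine Finset.sum_congr rfl fun τ _ => ?_
      rw [prod_glue, hpart, Finset.prod_singleton]
    · intro π hπ i hi j hj h
      simp only [Finset.mem_filter] at hπ
      exact hπ.2 j hj ((hπ.1.2 p hp i hi).trans h)
    · intro σ τ
      simp only [Finset.mem_filter, mem_ncPartitions, Finset.mem_singleton]
      rw [isNoncrossing_glue hd rfl σ τ fun i _ k hk j hj _ hjk => by
        have := hPS k hk j hj; omega]
      constructor
      · rintro ⟨⟨⟨-, hτ⟩, h⟩, -⟩
        refine ⟨?_, hτ⟩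
        have hPσ : P ∈ σ.parts := (mem_parts_iff_of_sameBlock hp).2 ⟨hp, fun j =>
          ⟨fun hj => hj.right_mem, fun hj => (sameBlock_glue_left hd rfl σ τ hp j).1
            (h p hp j hj)⟩⟩
        exact eq_indiscrete_of_mem hne hPσ
      · rintro ⟨rfl, hτ⟩
        have hmem : P ∈ (Finpartition.indiscrete hne).parts := by
          rw [hpart]; exact Finset.mem_singleton_self P
        refine ⟨⟨⟨isNoncrossing_of_mem _ hmem, hτ⟩, fun i hi j hj =>
          (sameBlock_glue_left hd rfl _ τ hi j).2 ⟨P, hmem, hi, hj⟩⟩, fun z hz h => ?_⟩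
        rw [sameBlock_glue_left hd rfl _ τ hp] at h
        exact Finset.disjoint_left.1 hd h.right_mem hz
  -- Otherwise let `z` be the first element of `S` in the block of `P`. As the partition is
  -- noncrossing, no block meets both the gap `below S z` and its complement.
  · rw [sum_eq_sum_fiber _ S
      (fun π z => SameBlock π p z ∧ ∀ y ∈ S, SameBlock π p y → z ≤ y)]
    · refine Finset.sum_congr rfl fun z hz => ?_
      have hdz : Disjoint (below S z) (insert z P ∪ above S z) := by
        refine Finset.disjoint_left.2 fun i hi hi' => ?_
        rw [mem_below] at hi
        simp only [Finset.mem_union, Finset.mem_insert, mem_above] at hi'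
        rcases hi' with (rfl | h) | h
        · omega
        · exact Finset.disjoint_left.1 hd h hi.1
        · omega
      have hTz : below S z ∪ (insert z P ∪ above S z) = P ∪ S := by
        ext i
        simp only [Finset.mem_union, Finset.mem_insert, mem_above, mem_below]
        grind
      rw [sum_glue hdz hTz (A₁ := ncPartitions (below S z))
        (A₂ := (ncPartitions (insert z P ∪ above S z)).filter
          (fun π => ∀ i ∈ insert z P, ∀ j ∈ insert z P, SameBlock π i j)),
        ncSum, ncSumBlock, Finset.sum_mul_sum]
      · simp only [prod_glue]
      · intro π hπ i hi j hj h
        simp only [Finset.mem_filter, mem_ncPartitions] at hπ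
        obtain ⟨⟨⟨hnc, hPπ⟩, -⟩, hpz, hfirst⟩ := hπ
        rw [mem_below] at hi
        have hpi : ¬SameBlock π p i := fun hpi => by
          have := hfirst i hi.1 hpi
          omega
        simp only [Finset.mem_union, Finset.mem_insert, mem_above] at hj
        rcases hj with (rfl | hj) | hj
        · exact hpi (hpz.trans h.symm)
        · exact hpi ((hPπ p hp j hj).trans h.symm)
        · exact hpi (hnc p i z j (hPS p hp i hi.1) hi.2 hj.2 hpz h)
      · intro σ τ
        simp only [Finset.mem_filter, mem_ncPartitions]
        have hpJ : p ∈ insert z P ∪ above S z := by simp [hp]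
        rw [isNoncrossing_glue hdz hTz σ τ fun i hi k hk j hj hij hjk => by
          rw [mem_below] at hi hk
          simp only [Finset.mem_union, Finset.mem_insert, mem_above] at hj
          rcases hj with (rfl | hj) | hj
          · omega
          · have := hPS j hj i hi.1; omega
          · omega]
        have hr : ∀ i ∈ insert z P, ∀ j, SameBlock (glue hdz hTz σ τ) i j ↔ SameBlock τ i j :=
          fun i hi j => sameBlock_glue_right hdz hTz σ τ (Finset.mem_union_left _ hi) j
        have hpz' : p ∈ insert z P := Finset.mem_insert_of_mem hp
        constructor
        · rintro ⟨⟨⟨⟨hσ, hτ⟩, hone⟩, -⟩, hpz, -⟩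
          refine ⟨hσ, hτ, ?_⟩
          have hall : ∀ i ∈ insert z P, SameBlock τ p i := by
            intro i hi
            rw [← hr p hpz']
            rcases Finset.mem_insert.1 hi with rfl | hi
            exacts [hpz, hone p hp i hi]
          exact fun i hi j hj => (hall i hi).symm.trans (hall j hj)
        · rintro ⟨hσ, hτ, hone⟩
          have hzz : z ∈ insert z P := Finset.mem_insert_self z P
          have hpz := (hr p hpz' z).2 (hone p hpz' z hzz)
          refine ⟨⟨⟨⟨hσ, hτ⟩, fun i hi j hj => ?_⟩, fun h => h z hz hpz⟩, hpz, ?_⟩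
          · exact (hr i (Finset.mem_insert_of_mem hi) j).2
              (hone i (Finset.mem_insert_of_mem hi) j (Finset.mem_insert_of_mem hj))
          · intro y hy hpy
            have hyJ := ((hr p hpz' y).1 hpy).right_mem
            simp only [Finset.mem_union, Finset.mem_insert, mem_above] at hyJ
            rcases hyJ with (rfl | h) | h
            · exact le_rfl
            · exact absurd hy (Finset.disjoint_left.1 hd h)
            · exact h.2.le
    · intro π hπ
      rw [Finset.mem_filter] at hπ
      have hne : (S.filter fun z => SameBlock π p z).Nonempty := by
        by_contra h
        rw [Finset.not_nonempty_iff_eq_empty, Finset.filter_eq_empty_iff] at h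
        exact hπ.2 fun z hz => h hz
      have hmin := Finset.mem_filter.1 ((S.filter fun z => SameBlock π p z).min'_mem hne)
      refine ⟨_, ⟨hmin.1, hmin.2, fun y hy hpy =>
        Finset.min'_le _ _ (Finset.mem_filter.2 ⟨hy, hpy⟩)⟩, ?_⟩
      rintro y ⟨hy, hpy, hle⟩
      exact le_antisymm (hle _ hmin.1 hmin.2) (Finset.min'_le _ _ (Finset.mem_filter.2 ⟨hy, hpy⟩))

end NCSum

/-- The moment-cumulant formula determines the cumulants. -/
theorem eq_of_ncSum_eq {R : Type*} [CommRing R] {f g : Finset ℕ → R}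
    (h : ∀ S : Finset ℕ, S.Nonempty → ncSum f S = ncSum g S) :
    ∀ S : Finset ℕ, S.Nonempty → f S = g S := by
  intro S
  induction S using Finset.strongInduction with
  | H S ih =>
    intro hS
    have hne : S ≠ ⊥ := hS.ne_empty
    have hpart : (Finpartition.indiscrete hne).parts = {S} := rfl
    have hmem : Finpartition.indiscrete hne ∈ ncPartitions S :=
      mem_ncPartitions.2 (isNoncrossing_of_mem _ (by rw [hpart]; exact Finset.mem_singleton_self S))
    have key := h S hS
    rw [ncSum, ncSum, ← Finset.add_sum_erase _ _ hmem, ← Finset.add_sum_erase _ _ hmem, hpart,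
      Finset.prod_singleton, Finset.prod_singleton] at key
    have hrest : ∑ π ∈ (ncPartitions S).erase (Finpartition.indiscrete hne), ∏ V ∈ π.parts, f V
        = ∑ π ∈ (ncPartitions S).erase (Finpartition.indiscrete hne), ∏ V ∈ π.parts, g V := by
      refine Finset.sum_congr rfl fun π hπ => Finset.prod_congr rfl fun V hV => ?_
      refine ih V (lt_of_le_of_ne (π.le hV) ?_) (π.nonempty_of_mem_parts hV)
      rintro rfl
      exact (Finset.mem_erase.1 hπ).1 (eq_indiscrete_of_mem hne hV)
    rw [hrest] at key
    exact add_right_cancel key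

/-! ### Noncrossing sums of the candidates for the cumulants -/

namespace Data

variable {B : Type*} [Ring B] [StarRing B] [Algebra ℂ B] [StarModule ℂ B] (D : Data B)

/-- The candidate for the free cumulant: `φ[u_{j_1} R'[u_{j_2}, …, u_{j_{l-1}}] u_{j_l}]` for
`V = {j_1 < ⋯ < j_l}` with `l ≥ 2`, and `0` for `l ≤ 1`. -/
def cumulantValue (u : ℕ → B) (V : Finset ℕ) : ℂ :=
  if h : 2 ≤ V.card then
    have hne : V.Nonempty := Finset.card_pos.1 (by omega)
    D.φ (u (V.min' hne) * D.Rprime u (inside V) (u (V.max' hne)))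
  else 0

theorem cumulantValue_singleton (u : ℕ → B) (m : ℕ) : D.cumulantValue u {m} = 0 := by
  simp [cumulantValue]

theorem cumulantValue_insert (u : ℕ → B) {P : Finset ℕ} {m z : ℕ} (hmz : m < z)
    (hP : ∀ p ∈ P, m < p ∧ p < z) :
    D.cumulantValue u (insert m (insert z P)) = D.φ (u m * D.Rprime u P (u z)) := by
  have hcard : 2 ≤ (insert m (insert z P)).card := by
    rw [← Finset.card_pair hmz.ne]
    exact Finset.card_le_card (by grind)
  rw [cumulantValue, dif_pos hcard]
  simp only [inside_eq hmz hP, min'_eq hmz hP, max'_eq hmz hP]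

/-- The sum over the subsets `T` of `S` of `R'[u_{P ∪ T}]` times the scalars obtained by filling
each gap that `T` leaves in `S` with noncrossing partitions weighted by `cumulantValue`. The
recursion is on the smallest element `z` of `T`. -/
def gapSum (u : ℕ → B) (P S : Finset ℕ) : Module.End ℂ B :=
  ncSum (D.cumulantValue u) S • D.Rprime u P
    + ∑ z ∈ S.attach, ncSum (D.cumulantValue u) (below S z)
        • gapSum u (insert z.1 P) (above S z)
termination_by S.card
decreasing_by exact above_card_lt z.2

theorem gapSum_eq (u : ℕ → B) (P S : Finset ℕ) :
    D.gapSum u P S = ncSum (D.cumulantValue u) S • D.Rprime u P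
      + ∑ z ∈ S, ncSum (D.cumulantValue u) (below S z) • D.gapSum u (insert z P) (above S z) := by
  rw [gapSum]
  congr 1
  exact Finset.sum_attach S fun z =>
    ncSum (D.cumulantValue u) (below S z) • D.gapSum u (insert z P) (above S z)

theorem gapSum_empty (u : ℕ → B) : D.gapSum u ∅ ∅ = 1 := by
  rw [gapSum_eq, ncSum_empty, Rprime_empty, Finset.sum_empty, one_smul, add_zero]

/-- Sorting the noncrossing partitions by the last element `y` of the block of `m`. -/
theorem ncSumBlock_cumulantValue (u : ℕ → B) {m : ℕ} {P S : Finset ℕ} (hP : ∀ p ∈ P, m < p)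
    (hS : ∀ s ∈ S, m < s) (hPS : ∀ p ∈ P, ∀ s ∈ S, p < s) :
    ncSumBlock (D.cumulantValue u) (insert m P) S
      = D.cumulantValue u (insert m P) * ncSum (D.cumulantValue u) S
        + ∑ y ∈ S, D.φ (u m * D.gapSum u P (below S y) (u y))
            * ncSum (D.cumulantValue u) (above S y) := by
  induction hn : S.card using Nat.strong_induction_on generalizing P S with
  | _ n ih =>
    subst hn
    have hmPS : ∀ p ∈ insert m P, ∀ s ∈ S, p < s := by
      intro p hp s hs
      rcases Finset.mem_insert.1 hp with rfl | hp
      exacts [hS s hs, hPS p hp s hs]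
    rw [ncSumBlock_eq _ (Finset.insert_nonempty m P) hmPS]
    congr 1
    -- `z` is the element following `m` and `P` in their block; it is the last one, or the last one
    -- is some `y > z`.
    have h1 : ∀ z ∈ S, ncSum (D.cumulantValue u) (below S z)
        * ncSumBlock (D.cumulantValue u) (insert z (insert m P)) (above S z)
        = ncSum (D.cumulantValue u) (below S z) * D.φ (u m * D.Rprime u P (u z))
            * ncSum (D.cumulantValue u) (above S z)
          + ∑ y ∈ above S z, ncSum (D.cumulantValue u) (below S z)
            * D.φ (u m * D.gapSum u (insert z P) (above (below S y) z) (u y))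
            * ncSum (D.cumulantValue u) (above S y) := by
      intro z hz
      rw [Finset.insert_comm, ih _ (above_card_lt hz) ?_ ?_ ?_ rfl,
        D.cumulantValue_insert u (hS z hz) fun p hp => ⟨hP p hp, hPS p hp z hz⟩, mul_add,
        Finset.mul_sum, mul_assoc]
      · congr 1
        refine Finset.sum_congr rfl fun y hy => ?_
        rw [above_above (mem_above.1 hy).2.le, below_above, mul_assoc]
      · intro p hp
        rcases Finset.mem_insert.1 hp with rfl | hp
        exacts [hS p hz, hP p hp]
      · exact fun s hs => hS s (mem_above.1 hs).1
      · intro p hp s hs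
        rw [mem_above] at hs
        rcases Finset.mem_insert.1 hp with rfl | hp
        exacts [hs.2, hPS p hp s hs.1]
    rw [Finset.sum_congr rfl h1, Finset.sum_add_distrib, sum_above_comm, ← Finset.sum_add_distrib]
    refine Finset.sum_congr rfl fun y _ => ?_
    rw [D.gapSum_eq u P (below S y)]
    simp only [LinearMap.add_apply, LinearMap.smul_apply, LinearMap.sum_apply, mul_add,
      Finset.mul_sum, mul_smul_comm, map_add, map_smul, map_sum, smul_eq_mul, add_mul,
      Finset.sum_mul]
    congr 1
    refine Finset.sum_congr rfl fun z hz => ?_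
    rw [below_below (mem_below.1 hz).2.le]

/-- The recursion for the noncrossing sums that the vacuum moments satisfy as well. -/
theorem ncSum_cumulantValue_insert (u : ℕ → B) {x : ℕ} {S : Finset ℕ} (hx : ∀ s ∈ S, x < s) :
    ncSum (D.cumulantValue u) (insert x S)
      = ∑ y ∈ S, D.φ (u x * D.gapSum u ∅ (below S y) (u y))
          * ncSum (D.cumulantValue u) (above S y) := by
  have h := D.ncSumBlock_cumulantValue u (m := x) (P := ∅) (S := S) (by simp) hx (by simp)
  rw [show insert x (∅ : Finset ℕ) = {x} from rfl, cumulantValue_singleton, zero_mul,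
    zero_add] at h
  rw [ncSum_insert, h]

/-- Multiplication by `γ[u_x T(u_z)]`, as a linear function of the operator `T`. -/
def γMul (u : ℕ → B) (x z : ℕ) : Module.End ℂ B →ₗ[ℂ] Module.End ℂ B :=
  LinearMap.mul ℂ B ∘ₗ D.γ ∘ₗ LinearMap.mulLeft ℂ (u x) ∘ₗ LinearMap.applyₗ (u z)

/-- Splitting off the first block of the interval partitions in `R'[u_{{x} ∪ P ∪ T}]`: it is `{x}`,
or it ends in `P`, or it ends in `S`. -/
theorem gapSum_insert_left (u : ℕ → B) {x : ℕ} {P S : Finset ℕ} (hP : ∀ p ∈ P, x < p)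
    (hS : ∀ s ∈ S, x < s) (hPS : ∀ p ∈ P, ∀ s ∈ S, p < s) :
    D.gapSum u (insert x P) S = D.ΛOp (u x) * D.gapSum u P S
      + ∑ z ∈ P, D.γMul u x z (D.Rprime u (below P z)) * D.gapSum u (above P z) S
      + ∑ y ∈ S, D.γMul u x y (D.gapSum u P (below S y)) * D.gapSum u ∅ (above S y) := by
  induction hn : S.card using Nat.strong_induction_on generalizing P S with
  | _ n ih =>
    subst hn
    have hR : D.Rprime u (insert x P) = D.ΛOp (u x) * D.Rprime u P
        + ∑ t ∈ P, D.γMul u x t (D.Rprime u (below P t)) * D.Rprime u (above P t) :=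
      D.Rprime_insert u hP
    -- The first block ends in `P`, at `z`, or at some `y > z`.
    have h1 : ∀ z ∈ S, ncSum (D.cumulantValue u) (below S z)
          • D.gapSum u (insert z (insert x P)) (above S z)
        = (ncSum (D.cumulantValue u) (below S z)
            • (D.ΛOp (u x) * D.gapSum u (insert z P) (above S z))
          + ∑ t ∈ P, ncSum (D.cumulantValue u) (below S z)
            • (D.γMul u x t (D.Rprime u (below P t))
              * D.gapSum u (insert z (above P t)) (above S z)))
          + (ncSum (D.cumulantValue u) (below S z)
            • (D.γMul u x z (D.Rprime u P) * D.gapSum u ∅ (above S z))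
          + ∑ y ∈ above S z, ncSum (D.cumulantValue u) (below S z)
            • (D.γMul u x y (D.gapSum u (insert z P) (above (below S y) z))
              * D.gapSum u ∅ (above S y))) := by
      intro z hz
      have hPz : ∀ p ∈ P, p < z := fun p hp => hPS p hp z hz
      have hzP : z ∉ P := fun h => lt_irrefl z (hPz z h)
      rw [Finset.insert_comm, ih _ (above_card_lt hz) ?_ ?_ ?_ rfl, Finset.sum_insert hzP,
        smul_add, smul_add, smul_add, Finset.smul_sum, Finset.smul_sum]
      · have e1 : below (insert z P) z = P := by
          ext i; simp only [mem_below, Finset.mem_insert]; grind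
        have e2 : above (insert z P) z = ∅ := by
          ext i; simp only [mem_above, Finset.mem_insert, Finset.notMem_empty]; grind
        have e3 : ∀ t ∈ P, ncSum (D.cumulantValue u) (below S z)
            • (D.γMul u x t (D.Rprime u (below (insert z P) t))
              * D.gapSum u (above (insert z P) t) (above S z))
            = ncSum (D.cumulantValue u) (below S z)
            • (D.γMul u x t (D.Rprime u (below P t))
              * D.gapSum u (insert z (above P t)) (above S z)) := fun t ht => by
          rw [below_insert_right (hPz t ht), above_insert_right (hPz t ht)]
        have e4 : ∀ y ∈ above S z, ncSum (D.cumulantValue u) (below S z)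
            • (D.γMul u x y (D.gapSum u (insert z P) (below (above S z) y))
              * D.gapSum u ∅ (above (above S z) y))
            = ncSum (D.cumulantValue u) (below S z)
            • (D.γMul u x y (D.gapSum u (insert z P) (above (below S y) z))
              * D.gapSum u ∅ (above S y)) := fun y hy => by
          rw [above_above (mem_above.1 hy).2.le, below_above]
        rw [e1, e2, Finset.sum_congr rfl e3, Finset.sum_congr rfl e4]
        abel
      · intro p hp
        rcases Finset.mem_insert.1 hp with rfl | hp
        exacts [hS p hz, hP p hp]
      · exact fun s hs => hS s (mem_above.1 hs).1
      · intro p hp s hs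
        rw [mem_above] at hs
        rcases Finset.mem_insert.1 hp with rfl | hp
        exacts [hs.2, hPS p hp s hs.1]
    rw [gapSum_eq, hR, Finset.sum_congr rfl h1, Finset.sum_add_distrib, Finset.sum_add_distrib,
      Finset.sum_add_distrib, sum_above_comm, Finset.sum_comm, ← Finset.sum_add_distrib]
    have h2 : D.ΛOp (u x) * D.gapSum u P S
        = ncSum (D.cumulantValue u) S • (D.ΛOp (u x) * D.Rprime u P)
          + ∑ z ∈ S, ncSum (D.cumulantValue u) (below S z)
            • (D.ΛOp (u x) * D.gapSum u (insert z P) (above S z)) := by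
      rw [D.gapSum_eq u P S, mul_add, Finset.mul_sum, mul_smul_comm]
      simp only [mul_smul_comm]
    have h3 : ∀ t ∈ P, D.γMul u x t (D.Rprime u (below P t)) * D.gapSum u (above P t) S
        = ncSum (D.cumulantValue u) S
            • (D.γMul u x t (D.Rprime u (below P t)) * D.Rprime u (above P t))
          + ∑ z ∈ S, ncSum (D.cumulantValue u) (below S z)
            • (D.γMul u x t (D.Rprime u (below P t))
              * D.gapSum u (insert z (above P t)) (above S z)) := by
      intro t _
      rw [D.gapSum_eq u (above P t) S, mul_add, Finset.mul_sum, mul_smul_comm]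
      simp only [mul_smul_comm]
    have h4 : ∀ y ∈ S, D.γMul u x y (D.gapSum u P (below S y)) * D.gapSum u ∅ (above S y)
        = ncSum (D.cumulantValue u) (below S y)
            • (D.γMul u x y (D.Rprime u P) * D.gapSum u ∅ (above S y))
          + ∑ z ∈ below S y, ncSum (D.cumulantValue u) (below S z)
            • (D.γMul u x y (D.gapSum u (insert z P) (above (below S y) z))
              * D.gapSum u ∅ (above S y)) := by
      intro y _
      rw [D.gapSum_eq u P (below S y), map_add, map_smul, map_sum, add_mul, Finset.sum_mul,
        smul_mul_assoc]
      congr 1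
      refine Finset.sum_congr rfl fun z hz => ?_
      rw [map_smul, smul_mul_assoc, below_below (mem_below.1 hz).2.le]
    rw [h2, Finset.sum_congr rfl h3, Finset.sum_congr rfl h4, smul_add, Finset.smul_sum]
    simp only [Finset.sum_add_distrib]
    abel

/-- Splitting off the first factor: in `γ + φ`, the map `φ` accounts for the subsets whose first gap
contains `x`, and `γ` for the first block of `R'` if `x` lies in the subset. -/
theorem gapSum_empty_insert (u : ℕ → B) {x : ℕ} {S : Finset ℕ} (hx : ∀ s ∈ S, x < s) :
    D.gapSum u ∅ (insert x S) = D.ΛOp (u x) * D.gapSum u ∅ S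
      + ∑ z ∈ S, LinearMap.mulLeft ℂ (D.γφ (u x * D.gapSum u ∅ (below S z) (u z)))
          * D.gapSum u ∅ (above S z) := by
  have hxS : x ∉ S := fun h => lt_irrefl x (hx x h)
  have hγφ : ∀ z ∈ S, LinearMap.mulLeft ℂ (D.γφ (u x * D.gapSum u ∅ (below S z) (u z)))
        * D.gapSum u ∅ (above S z)
      = D.γMul u x z (D.gapSum u ∅ (below S z)) * D.gapSum u ∅ (above S z)
        + (D.φ (u x * D.gapSum u ∅ (below S z) (u z))
            • (ncSum (D.cumulantValue u) (above S z) • D.Rprime u ∅)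
          + ∑ y ∈ above S z, (D.φ (u x * D.gapSum u ∅ (below S z) (u z))
            * ncSum (D.cumulantValue u) (above (below S y) z))
              • D.gapSum u {y} (above S y)) := by
    intro z _
    have e : LinearMap.mulLeft ℂ (D.γφ (u x * D.gapSum u ∅ (below S z) (u z)))
        = D.γMul u x z (D.gapSum u ∅ (below S z))
          + D.φ (u x * D.gapSum u ∅ (below S z) (u z)) • 1 := by
      ext v
      simp [γφ, γMul, add_mul, Algebra.algebraMap_eq_smul_one]
    rw [e, add_mul, smul_mul_assoc, one_mul]
    congr 1
    rw [D.gapSum_eq u ∅ (above S z), smul_add, Finset.smul_sum]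
    congr 1
    refine Finset.sum_congr rfl fun y hy => ?_
    rw [smul_smul, above_above (mem_above.1 hy).2.le, below_above]
    rfl
  -- The subsets with smallest element `y ≠ x`: the gap before `y` starts with `x`.
  have hrec : ∀ y ∈ S, ncSum (D.cumulantValue u) (below (insert x S) y)
        • D.gapSum u (insert y ∅) (above (insert x S) y)
      = ∑ z ∈ below S y, (D.φ (u x * D.gapSum u ∅ (below S z) (u z))
            * ncSum (D.cumulantValue u) (above (below S y) z))
              • D.gapSum u {y} (above S y) := by
    intro y hy
    rw [below_insert (hx y hy), above_insert (hx y hy),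
      D.ncSum_cumulantValue_insert u fun s hs => hx s (mem_below.1 hs).1, Finset.sum_smul]
    refine Finset.sum_congr rfl fun z hz => ?_
    rw [below_below (mem_below.1 hz).2.le]
    rfl
  -- The subsets containing `x`.
  have hleft : D.gapSum u (insert x ∅) S = D.ΛOp (u x) * D.gapSum u ∅ S
      + ∑ y ∈ S, D.γMul u x y (D.gapSum u ∅ (below S y)) * D.gapSum u ∅ (above S y) := by
    rw [D.gapSum_insert_left u (by simp) hx (by simp), Finset.sum_empty, add_zero]
  rw [gapSum_eq, Finset.sum_insert hxS, below_insert_self hx, above_insert_self hx, ncSum_empty,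
    one_smul, hleft, Finset.sum_congr rfl hrec, Finset.sum_congr rfl hγφ,
    Finset.sum_add_distrib, Finset.sum_add_distrib, sum_above_comm,
    D.ncSum_cumulantValue_insert u hx, Finset.sum_smul]
  simp only [mul_smul]
  abel

end Data

/-! ### Moments of the operators `X(b)` -/

section Fock

variable {B : Type*} [Ring B] [Algebra ℂ B]

theorem fock_hom_ext {M : Type*} [AddCommGroup M] [Module ℂ M] {f g : Fock B →ₗ[ℂ] M}
    (h : ∀ n v, f (tens B n v) = g (tens B n v)) : f = g := by
  refine DirectSum.linearMap_ext ℂ fun n => PiTensorProduct.ext ?_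
  ext v
  exact h n v

theorem aPlus_add (b c : B) : aPlus (b + c) = aPlus b + aPlus c := by
  refine fock_hom_ext fun n v => ?_
  simp only [LinearMap.add_apply]
  simp [aPlus, fockLift_tens]

theorem aPlus_smul (r : ℂ) (b : B) : aPlus (r • b) = r • aPlus b := by
  refine fock_hom_ext fun n v => ?_
  simp only [LinearMap.smul_apply]
  simp [aPlus, fockLift_tens]

/-- Creation as a linear function of the created vector. -/
def aPlusHom : B →ₗ[ℂ] Module.End ℂ (Fock B) where
  toFun := aPlus
  map_add' := aPlus_add
  map_smul' := aPlus_smul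

theorem aPlus_sum {ι : Type*} (S : Finset ι) (f : ι → B) :
    aPlus (∑ i ∈ S, f i) = ∑ i ∈ S, aPlus (f i) :=
  map_sum aPlusHom f S

theorem aPlus_vacuum (b : B) : aPlus b (vacuum B) = single b := by
  rw [vacuum, aPlus_tens, single]
  congr 1
  ext i
  obtain rfl := Fin.fin_one_eq_zero i
  rfl

theorem firstSlot_aPlus (M : Module.End ℂ B) (b : B) (η : Fock B) :
    firstSlot M (aPlus b η) = aPlus (M b) η := by
  suffices h : firstSlot M ∘ₗ aPlus b = aPlus (M b) from LinearMap.congr_fun h η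
  refine fock_hom_ext fun n v => ?_
  rw [LinearMap.comp_apply, aPlus_tens, firstSlot_tens, aPlus_tens]
  simp

theorem contract_aPlus_vacuum (L : B →ₗ[ℂ] B) (ℓ : B →ₗ[ℂ] ℂ) (b x : B) :
    contract L ℓ b (aPlus x (vacuum B)) = ℓ (b * x) • vacuum B := by
  rw [aPlus_vacuum, contract_single]

theorem contract_aPlus_aPlus (L : B →ₗ[ℂ] B) (ℓ : B →ₗ[ℂ] ℂ) (b x y : B) (η : Fock B) :
    contract L ℓ b (aPlus x (aPlus y η)) = aPlus (L (b * x) * y) η := by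
  suffices h : contract L ℓ b ∘ₗ aPlus x ∘ₗ aPlus y = aPlus (L (b * x) * y) from
    LinearMap.congr_fun h η
  refine fock_hom_ext fun n v => ?_
  rw [LinearMap.comp_apply, LinearMap.comp_apply, aPlus_tens, aPlus_tens, contract_tens,
    aPlus_tens]
  simp

end Fock

namespace Data

variable {B : Type*} [Ring B] [StarRing B] [Algebra ℂ B] [StarModule ℂ B] (D : Data B)

theorem ip_vacuum_vacuum : D.ip (vacuum B) (vacuum B) = 1 := by
  rw [vacuum, ip_tens]; rfl

theorem ip_aPlus_vacuum (b : B) (η : Fock B) : D.ip (aPlus b η) (vacuum B) = 0 := by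
  suffices h : D.ip.flip (vacuum B) ∘ₗ aPlus b = 0 from LinearMap.congr_fun h η
  refine fock_hom_ext fun n v => ?_
  rw [LinearMap.comp_apply, aPlus_tens]
  exact D.ip_tens_of_ne (Nat.succ_ne_zero n) _ _

/-- The part of `∏_{i ∈ S} X(u_i) (v ⊗ η)` in which the leg that starts as `v` is never
contracted. The first term collects the contributions without further legs on top of it; in the
term of `z`, the lowest leg on top of it that is still present was created by `a^+(u_z)`. -/
def stayVec (u : ℕ → B) (S : Finset ℕ) (v : B) (η : Fock B) : Fock B :=
  aPlus (D.gapSum u ∅ S v) η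
    + ∑ z ∈ S.attach, stayVec u (below S z) (u z) (aPlus (D.gapSum u ∅ (above S z) v) η)
termination_by S.card
decreasing_by exact below_card_lt z.2

theorem stayVec_eq (u : ℕ → B) (S : Finset ℕ) (v : B) (η : Fock B) :
    D.stayVec u S v η = aPlus (D.gapSum u ∅ S v) η
      + ∑ z ∈ S, D.stayVec u (below S z) (u z) (aPlus (D.gapSum u ∅ (above S z) v) η) := by
  rw [stayVec]
  congr 1
  exact Finset.sum_attach S fun z =>
    D.stayVec u (below S z) (u z) (aPlus (D.gapSum u ∅ (above S z) v) η)

theorem stayVec_empty (u : ℕ → B) (v : B) (η : Fock B) : D.stayVec u ∅ v η = aPlus v η := by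
  rw [stayVec_eq, Finset.sum_empty, add_zero, gapSum_empty, Module.End.one_apply]

/-- Applying a further operator `X(u_x)` either keeps the leg or contracts it, and the latter is
possible only when all legs above it are gone. -/
theorem X_stayVec (u : ℕ → B) {x : ℕ} {S : Finset ℕ} (hx : ∀ s ∈ S, x < s) (v : B) (η : Fock B) :
    D.X (u x) (D.stayVec u S v η) = D.stayVec u (insert x S) v η
      + D.aMinus (u x) (aPlus (D.gapSum u ∅ S v) η) := by
  induction hn : S.card using Nat.strong_induction_on generalizing S v η with
  | _ n ih =>
    subst hn
    have hxS : x ∉ S := fun h => lt_irrefl x (hx x h)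
    have h1 : ∀ z ∈ S, D.X (u x)
          (D.stayVec u (below S z) (u z) (aPlus (D.gapSum u ∅ (above S z) v) η))
        = D.stayVec u (below (insert x S) z) (u z)
            (aPlus (D.gapSum u ∅ (above (insert x S) z) v) η)
          + aPlus (D.γφ (u x * D.gapSum u ∅ (below S z) (u z)) * D.gapSum u ∅ (above S z) v) η := by
      intro z hz
      rw [ih _ (below_card_lt hz) (fun s hs => hx s (mem_below.1 hs).1) _ _ rfl,
        below_insert (hx z hz), above_insert (hx z hz), aMinus, contract_aPlus_aPlus]
    rw [D.stayVec_eq u S, map_add, map_sum, Finset.sum_congr rfl h1, Finset.sum_add_distrib,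
      D.stayVec_eq u (insert x S), Finset.sum_insert hxS, below_insert_self hx,
      above_insert_self hx, stayVec_empty, D.gapSum_empty_insert u hx]
    simp only [X, aZero, LinearMap.add_apply, firstSlot_aPlus, aPlus_add, LinearMap.sum_apply,
      aPlus_sum, Module.End.mul_apply, LinearMap.mulLeft_apply]
    abel

/-- The vector `∏_{i ∈ S} X(u_i) Ω`, sorted by the index `z` that creates the lowest remaining
leg. -/
theorem orderedProd_X_vacuum (u : ℕ → B) (S : Finset ℕ) :
    orderedProd S (fun i => D.X (u i)) (vacuum B)
      = ncSum (D.cumulantValue u) S • vacuum B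
        + ∑ z ∈ S, ncSum (D.cumulantValue u) (above S z)
            • D.stayVec u (below S z) (u z) (vacuum B) := by
  induction S using insert_min_induction with
  | empty => simp [orderedProd_empty, ncSum_empty]
  | insert_min x S hx ih =>
    have hxS : x ∉ S := fun h => lt_irrefl x (hx x h)
    have hX : D.X (u x) (vacuum B) = aPlus (u x) (vacuum B) := by
      simp [X, aMinus, aZero, contract_vacuum, firstSlot_vacuum]
    have h1 : ∀ z ∈ S, D.X (u x) (ncSum (D.cumulantValue u) (above S z)
          • D.stayVec u (below S z) (u z) (vacuum B))
        = ncSum (D.cumulantValue u) (above (insert x S) z)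
            • D.stayVec u (below (insert x S) z) (u z) (vacuum B)
          + (D.φ (u x * D.gapSum u ∅ (below S z) (u z))
            * ncSum (D.cumulantValue u) (above S z)) • vacuum B := by
      intro z hz
      rw [map_smul, D.X_stayVec u fun s hs => hx s (mem_below.1 hs).1, below_insert (hx z hz),
        above_insert (hx z hz), aMinus, contract_aPlus_vacuum, smul_add, smul_smul, mul_comm]
    rw [orderedProd_insert hx, Module.End.mul_apply, ih, map_add, map_smul, map_sum, hX,
      Finset.sum_congr rfl h1, Finset.sum_add_distrib, Finset.sum_insert hxS,
      below_insert_self hx, above_insert_self hx, stayVec_empty,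
      D.ncSum_cumulantValue_insert u hx, Finset.sum_smul]
    abel

theorem ip_stayVec_vacuum (u : ℕ → B) (S : Finset ℕ) (v : B) (η : Fock B) :
    D.ip (D.stayVec u S v η) (vacuum B) = 0 := by
  induction hn : S.card using Nat.strong_induction_on generalizing S v η with
  | _ n ih =>
    subst hn
    rw [stayVec_eq, map_add, LinearMap.add_apply, ip_aPlus_vacuum, map_sum, LinearMap.sum_apply,
      Finset.sum_eq_zero, add_zero]
    exact fun z hz => ih _ (below_card_lt hz) _ _ _ rfl

theorem vacuumState_orderedProd_X (u : ℕ → B) (S : Finset ℕ) :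
    D.vacuumState (orderedProd S fun i => D.X (u i)) = ncSum (D.cumulantValue u) S := by
  rw [vacuumState, orderedProd_X_vacuum]
  simp [ip_vacuum_vacuum, ip_stayVec_vacuum]

theorem freeCumulant_X (u : ℕ → B) {S : Finset ℕ} (hS : S.Nonempty) :
    freeCumulant D.vacuumState (fun i => D.X (u i)) S = D.cumulantValue u S := by
  refine eq_of_ncSum_eq (fun T hT => ?_) S hS
  rw [← D.vacuumState_orderedProd_X u T]
  exact (moment_eq_sum_freeCumulant _ _ T hT).symm

end Data

/-! ### Noncrossing partitions with an outer block -/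

open scoped Classical in
/-- The noncrossing partitions of `T` without singleton blocks in which all elements of `P` lie in
the same block as `t`. -/
def outerPartitions (T P : Finset ℕ) (t : ℕ) : Finset (Finpartition T) :=
  Finset.univ.filter fun π =>
    IsNoncrossing π ∧ (∀ p ∈ P, SameBlock π p t) ∧ ∀ V ∈ π.parts, V.card ≠ 1

theorem mem_outerPartitions {T P : Finset ℕ} {t : ℕ} {π : Finpartition T} :
    π ∈ outerPartitions T P t ↔
      IsNoncrossing π ∧ (∀ p ∈ P, SameBlock π p t) ∧ ∀ V ∈ π.parts, V.card ≠ 1 := by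
  simp [outerPartitions]

/-- If no block is a singleton, each element shares its block with another one. -/
theorem exists_ne_sameBlock {T : Finset ℕ} {π : Finpartition T} (h : ∀ V ∈ π.parts, V.card ≠ 1)
    {i : ℕ} (hi : i ∈ T) : ∃ j, j ≠ i ∧ SameBlock π i j := by
  obtain ⟨V, hV, hiV⟩ := π.exists_mem hi
  by_contra! hcon
  refine h V hV (Finset.card_eq_one.2
    ⟨i, Finset.eq_singleton_iff_unique_mem.2 ⟨hiV, fun j hj => ?_⟩⟩)
  by_contra hne
  exact hcon j hne ⟨V, hV, hiV, hj⟩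

/-- The partitions in `outerPartitions` in which the smallest element `a` outside `P` is not in the
outer block, and in which the block of `a` ends at `z`: the elements between `a` and `z` are
separated from all others. -/
theorem sum_outerPartitions_inner_block {M : Type*} [AddCommMonoid M] {T P S : Finset ℕ}
    {a t z : ℕ} (hPa : ∀ p ∈ P, p < a) (ha : ∀ s ∈ S, a < s) (hSt : ∀ s ∈ S, s < t) (hz : z ∈ S)
    (hd : Disjoint ({a} ∪ insert z (below S z)) (P ∪ insert t (above S z)))
    (hT : {a} ∪ insert z (below S z) ∪ (P ∪ insert t (above S z)) = T)
    {A : Finset (Finpartition T)}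
    (hA : ∀ π, π ∈ A ↔ π ∈ outerPartitions T P t ∧ ¬SameBlock π a t ∧ SameBlock π a z ∧
      IsClosing π z) (F : Finpartition T → M) :
    ∑ π ∈ A, F π = ∑ σ ∈ outerPartitions ({a} ∪ insert z (below S z)) {a} z,
      ∑ τ ∈ outerPartitions (P ∪ insert t (above S z)) P t, F (glue hd hT σ τ) := by
  have haz := ha z hz
  have hzt := hSt z hz
  have hI : ∀ i ∈ ({a} ∪ insert z (below S z) : Finset ℕ), i = a ∨ i = z ∨ (a < i ∧ i < z) := by
    intro i hi
    simp only [Finset.mem_union, Finset.mem_singleton, Finset.mem_insert, mem_below] at hi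
    rcases hi with rfl | rfl | hi
    exacts [.inl rfl, .inr (.inl rfl), .inr (.inr ⟨ha i hi.1, hi.2⟩)]
  have hJ : ∀ j ∈ P ∪ insert t (above S z), j ∈ P ∨ j = t ∨ (j ∈ S ∧ z < j) := by
    intro j hj
    simpa only [Finset.mem_union, Finset.mem_insert, mem_above] using hj
  refine sum_glue hd hT ?_ ?_ F
  · intro π hπ i hi j hj hij
    obtain ⟨hout, hat, haz', hcl⟩ := (hA π).1 hπ
    obtain ⟨hnc, hP, -⟩ := mem_outerPartitions.1 hout
    have hmax := (isClosing_iff.1 hcl).2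
    have hit : ¬SameBlock π i t := by
      rcases hI i hi with rfl | rfl | ⟨h1, h2⟩
      · exact hat
      · exact fun h => hat (haz'.trans h)
      · exact fun h => hat ((hnc a i z t h1 h2 hzt haz' h).trans h)
    rcases hJ j hj with hj | rfl | ⟨-, hzj⟩
    · exact hit (hij.trans (hP j hj))
    · exact hit hij
    · have haj : SameBlock π a j := by
        rcases hI i hi with rfl | rfl | ⟨h1, h2⟩
        · exact hij
        · exact haz'.trans hij
        · exact (hnc a i z j h1 h2 hzj haz' hij).trans hij
      have := hmax j (haz'.symm.trans haj)
      omega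
  · intro σ τ
    have haI : a ∈ ({a} ∪ insert z (below S z) : Finset ℕ) := by simp
    have hzI : z ∈ ({a} ∪ insert z (below S z) : Finset ℕ) := by simp
    rw [hA, mem_outerPartitions, mem_outerPartitions, mem_outerPartitions,
      isNoncrossing_glue hd hT σ τ fun i hi k hk j hj hij hjk => by
        have h1 := hI i hi
        have h2 := hI k hk
        rcases hJ j hj with hj | rfl | ⟨-, hzj⟩
        · have := hPa j hj; omega
        · omega
        · omega,
      sameBlock_glue_left hd hT σ τ haI, sameBlock_glue_left hd hT σ τ haI]
    have hP : (∀ p ∈ P, SameBlock (glue hd hT σ τ) p t) ↔ ∀ p ∈ P, SameBlock τ p t :=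
      forall₂_congr fun p hp =>
        sameBlock_glue_right hd hT σ τ (Finset.mem_union_left _ hp) t
    have hcard : (∀ V ∈ (glue hd hT σ τ).parts, V.card ≠ 1) ↔
        (∀ V ∈ σ.parts, V.card ≠ 1) ∧ ∀ V ∈ τ.parts, V.card ≠ 1 := by
      simp only [glue_parts, Finset.mem_union, or_imp, forall_and]
    have hat : ¬SameBlock σ a t := fun h => by
      have := hI t h.right_mem
      omega
    have hcl : IsClosing (glue hd hT σ τ) z := by
      refine (isClosing_glue hd hT σ τ z).2 (.inl (isClosing_iff.2 ⟨hzI, fun j hj => ?_⟩))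
      have := hI j hj.right_mem
      omega
    have hone : (∀ p ∈ ({a} : Finset ℕ), SameBlock σ p z) ↔ SameBlock σ a z := by simp
    rw [hP, hcard, hone]
    tauto

namespace Data

variable {B : Type*} [Ring B] [StarRing B] [Algebra ℂ B] [StarModule ℂ B] (D : Data B)

open scoped Classical in
/-- The operator attached to an element `i` of a partition: `a^+(u_i)` if `i` is closing,
otherwise `a_γ^∼(u_i)` if `i` is opening, and `a^0(u_i)` if `i` is a middle element. -/
def typeOp (u : ℕ → B) {T : Finset ℕ} (π : Finpartition T) (i : ℕ) : Module.End ℂ (Fock B) :=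
  if IsClosing π i then aPlus (u i)
  else if IsOpening π i then D.aGamma (u i)
  else D.aZero (u i)

theorem typeOp_glue_left (u : ℕ → B) {I J T : Finset ℕ} (hd : Disjoint I J) (hT : I ∪ J = T)
    (σ : Finpartition I) (τ : Finpartition J) {i : ℕ} (hi : i ∈ I) :
    D.typeOp u (glue hd hT σ τ) i = D.typeOp u σ i := by
  have hiJ : i ∉ J := Finset.disjoint_left.1 hd hi
  have h1 : IsClosing (glue hd hT σ τ) i ↔ IsClosing σ i :=
    (isClosing_glue hd hT σ τ i).trans
      (or_iff_left fun h => hiJ (isClosing_iff.1 h).1)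
  have h2 : IsOpening (glue hd hT σ τ) i ↔ IsOpening σ i :=
    (isOpening_glue hd hT σ τ i).trans
      (or_iff_left fun h => hiJ (isOpening_iff.1 h).1)
  classical simp only [typeOp, h1, h2]

theorem typeOp_glue_right (u : ℕ → B) {I J T : Finset ℕ} (hd : Disjoint I J) (hT : I ∪ J = T)
    (σ : Finpartition I) (τ : Finpartition J) {i : ℕ} (hi : i ∈ J) :
    D.typeOp u (glue hd hT σ τ) i = D.typeOp u τ i := by
  have hiI : i ∉ I := fun h => Finset.disjoint_left.1 hd h hi
  have h1 : IsClosing (glue hd hT σ τ) i ↔ IsClosing τ i :=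
    (isClosing_glue hd hT σ τ i).trans
      (or_iff_right fun h => hiI (isClosing_iff.1 h).1)
  have h2 : IsOpening (glue hd hT σ τ) i ↔ IsOpening τ i :=
    (isOpening_glue hd hT σ τ i).trans
      (or_iff_right fun h => hiI (isOpening_iff.1 h).1)
  classical simp only [typeOp, h1, h2]

/-- The sum of the operator products over the noncrossing partitions whose outer block contains `P`
and the last element `t`. The smallest element `a` of `S` is either a middle element of the outer
block or the first element of an inner block ending at some `z`; these are the two cases of the
recursion for `R'`. -/
theorem sum_outerPartitions (u : ℕ → B) {T P S : Finset ℕ} {t : ℕ} (hT : P ∪ insert t S = T)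
    (hP : P.Nonempty) (hPt : ∀ p ∈ P, p < t) (hPS : ∀ p ∈ P, ∀ s ∈ S, p < s)
    (hSt : ∀ s ∈ S, s < t) (η : Fock B) :
    ∑ π ∈ outerPartitions T P t, orderedProd (insert t S) (D.typeOp u π) η
      = aPlus (D.Rprime u S (u t)) η := by
  classical
  induction hn : S.card using Nat.strong_induction_on generalizing T P S t η with
  | _ n ih =>
    subst hn
    obtain ⟨p, hp⟩ := hP
    have htT : t ∈ T := hT ▸ by simp
    have hle : ∀ i ∈ T, i ≤ t := by
      intro i hi
      rw [← hT, Finset.mem_union, Finset.mem_insert] at hi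
      rcases hi with h | rfl | h
      exacts [(hPt i h).le, le_rfl, (hSt i h).le]
    have hpT : p ∈ T := hT ▸ Finset.mem_union_left _ hp
    rcases S.eq_empty_or_nonempty with rfl | hS
    · have hne : T ≠ ⊥ := Finset.ne_empty_of_mem htT
      have hpart : (Finpartition.indiscrete hne).parts = {T} := rfl
      have hTT : T ∈ (Finpartition.indiscrete hne).parts := by
        rw [hpart]; exact Finset.mem_singleton_self T
      have hA : outerPartitions T P t = {Finpartition.indiscrete hne} := by
        ext π
        rw [mem_outerPartitions, Finset.mem_singleton]
        constructor
        · rintro ⟨-, hone, -⟩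
          refine eq_indiscrete_of_mem hne ((mem_parts_iff_of_sameBlock htT).2 ⟨htT, fun j =>
            ⟨fun h => h.right_mem, fun hj => ?_⟩⟩)
          have hj' := hj
          rw [← hT, Finset.mem_union, Finset.mem_insert] at hj'
          rcases hj' with h | rfl | h
          · exact (hone j h).symm
          · exact sameBlock_refl hj
          · exact absurd h (Finset.notMem_empty j)
        · rintro rfl
          refine ⟨isNoncrossing_of_mem _ hTT, fun q hq =>
            ⟨T, hTT, hT ▸ Finset.mem_union_left _ hq, htT⟩, fun V hV => ?_⟩
          rw [hpart, Finset.mem_singleton] at hV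
          subst hV
          exact (Finset.one_lt_card.2 ⟨p, hpT, t, htT, (hPt p hp).ne⟩).ne'
      have hcl : IsClosing (Finpartition.indiscrete hne) t :=
        isClosing_iff.2 ⟨htT, fun j hj => hle j hj.right_mem⟩
      rw [hA, Finset.sum_singleton, orderedProd_insert (by simp), orderedProd_empty, mul_one,
        typeOp, if_pos hcl, Rprime_empty, Module.End.one_apply]
    · obtain ⟨a, S, ha, rfl⟩ : ∃ a S', (∀ s ∈ S', a < s) ∧ S = insert a S' :=
        ⟨S.min' hS, S.erase (S.min' hS), fun s hs => S.min'_lt_of_mem_erase_min' hS hs,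
          (Finset.insert_erase (S.min'_mem hS)).symm⟩
      have haS : a ∉ S := fun h => lt_irrefl a (ha a h)
      have hat : a < t := hSt a (Finset.mem_insert_self a S)
      have hPa : ∀ q ∈ P, q < a := fun q hq => hPS q hq a (Finset.mem_insert_self a S)
      have hSt' : ∀ s ∈ S, s < t := fun s hs => hSt s (Finset.mem_insert_of_mem hs)
      have hPS' : ∀ q ∈ P, ∀ s ∈ S, q < s := fun q hq s hs =>
        hPS q hq s (Finset.mem_insert_of_mem hs)
      have hcard : S.card < (insert a S).card := by
        rw [Finset.card_insert_of_notMem haS]; exact Nat.lt_succ_self _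
      have haT : a ∈ T := hT ▸ by simp
      have hat' : ∀ s ∈ insert t S, a < s := by
        intro s hs
        rcases Finset.mem_insert.1 hs with rfl | hs
        exacts [hat, ha s hs]
      rw [← Finset.sum_filter_add_sum_filter_not _ (fun π => SameBlock π a t),
        D.Rprime_insert u ha, LinearMap.add_apply, aPlus_add, LinearMap.add_apply]
      congr 1
      -- `a` is a middle element of the outer block.
      · have hA : (outerPartitions T P t).filter (fun π => SameBlock π a t)
            = outerPartitions T (insert a P) t := by
          ext π
          rw [Finset.mem_filter, mem_outerPartitions, mem_outerPartitions,
            Finset.forall_mem_insert]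
          tauto
        have h1 : ∀ π ∈ outerPartitions T (insert a P) t,
            orderedProd (insert t (insert a S)) (D.typeOp u π) η
              = D.aZero (u a) (orderedProd (insert t S) (D.typeOp u π) η) := by
          intro π hπ
          obtain ⟨-, hone, -⟩ := mem_outerPartitions.1 hπ
          have hat_block := hone a (Finset.mem_insert_self a P)
          have hpt_block := hone p (Finset.mem_insert_of_mem hp)
          have hcl : ¬IsClosing π a := fun h =>
            absurd ((isClosing_iff.1 h).2 t hat_block) (by omega)
          have hop : ¬IsOpening π a := fun h => by
            have := (isOpening_iff.1 h).2 p (hat_block.trans hpt_block.symm)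
            have := hPa p hp
            omega
          rw [Finset.insert_comm, orderedProd_insert hat', Module.End.mul_apply]
          congr 1
          rw [typeOp, if_neg hcl, if_neg hop]
        rw [hA, Finset.sum_congr rfl h1, ← map_sum,
          ih S.card hcard (P := insert a P) (by rw [← hT]; grind) (Finset.insert_nonempty a P)
            (by simpa using ⟨hat, hPt⟩) (by simpa using ⟨ha, hPS'⟩) hSt' η rfl,
          aZero, firstSlot_aPlus, Module.End.mul_apply]
      -- `a` starts an inner block; `z` is its last element.
      · rw [sum_eq_sum_fiber _ S (fun π z => SameBlock π a z ∧ IsClosing π z),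
          LinearMap.sum_apply, aPlus_sum, LinearMap.sum_apply]
        · refine Finset.sum_congr rfl fun z hz => ?_
          have haz := ha z hz
          have hzt := hSt' z hz
          have hd : Disjoint ({a} ∪ insert z (below S z)) (P ∪ insert t (above S z)) := by
            refine Finset.disjoint_left.2 fun i hi hi' => ?_
            simp only [Finset.mem_union, Finset.mem_singleton, Finset.mem_insert, mem_below,
              mem_above] at hi hi'
            grind
          have hTz : {a} ∪ insert z (below S z) ∪ (P ∪ insert t (above S z)) = T := by
            rw [← hT]
            ext i
            simp only [Finset.mem_union, Finset.mem_singleton, Finset.mem_insert, mem_below,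
              mem_above]
            grind
          rw [sum_outerPartitions_inner_block hPa ha hSt' hz hd hTz fun π => by
            rw [Finset.mem_filter, Finset.mem_filter, and_assoc]]
          have h1 : ∀ σ ∈ outerPartitions ({a} ∪ insert z (below S z)) {a} z,
              ∀ τ ∈ outerPartitions (P ∪ insert t (above S z)) P t,
              orderedProd (insert t (insert a S)) (D.typeOp u (glue hd hTz σ τ)) η
                = D.aGamma (u a) (orderedProd (insert z (below S z)) (D.typeOp u σ)
                    (orderedProd (insert t (above S z)) (D.typeOp u τ) η)) := by
            intro σ hσ τ _
            obtain ⟨-, hone, -⟩ := mem_outerPartitions.1 hσ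
            have haz_block := hone a (Finset.mem_singleton_self a)
            have hcl : ¬IsClosing σ a := fun h =>
              absurd ((isClosing_iff.1 h).2 z haz_block) (by omega)
            have hop : IsOpening σ a := by
              refine isOpening_iff.2 ⟨by simp, fun j hj => ?_⟩
              have := hj.right_mem
              simp only [Finset.mem_union, Finset.mem_singleton, Finset.mem_insert,
                mem_below] at this
              grind
            have hS : insert t S = insert z (below S z) ∪ insert t (above S z) := by
              ext i
              simp only [Finset.mem_union, Finset.mem_insert, mem_below, mem_above]
              grind
            have hlt : ∀ s ∈ insert z (below S z), ∀ s' ∈ insert t (above S z), s < s' := by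
              intro s hs s' hs'
              simp only [Finset.mem_insert, mem_below, mem_above] at hs hs'
              grind
            rw [Finset.insert_comm, orderedProd_insert hat', hS, orderedProd_union hlt,
              typeOp_glue_left D u hd hTz σ τ (by simp),
              orderedProd_congr (S := insert z (below S z)) (g := D.typeOp u σ) fun i hi =>
                D.typeOp_glue_left u hd hTz σ τ (Finset.mem_union_right _ hi),
              orderedProd_congr (S := insert t (above S z)) (g := D.typeOp u τ) fun i hi =>
                D.typeOp_glue_right u hd hTz σ τ (Finset.mem_union_right _ hi),
              Module.End.mul_apply, Module.End.mul_apply]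
            congr 1
            rw [typeOp, if_neg hcl, if_pos hop]
          rw [Finset.sum_congr rfl fun σ hσ => Finset.sum_congr rfl (h1 σ hσ)]
          simp only [← map_sum]
          rw [ih _ ((above_card_lt hz).trans hcard) rfl ⟨p, hp⟩ hPt
              (fun q hq s hs => hPS' q hq s (mem_above.1 hs).1)
              (fun s hs => hSt' s (mem_above.1 hs).1) η rfl,
            ih _ ((below_card_lt hz).trans hcard) rfl (Finset.singleton_nonempty a)
              (by simpa using haz) (by simpa using fun s hs _ => ha s hs)
              (fun s hs => (mem_below.1 hs).2) _ rfl,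
            aGamma, contract_aPlus_aPlus, Module.End.mul_apply, LinearMap.mulLeft_apply]
        · intro π hπ
          rw [Finset.mem_filter, mem_outerPartitions] at hπ
          obtain ⟨⟨-, hone, hns⟩, hat_block⟩ := hπ
          obtain ⟨z, ⟨hzT, haz, hcl⟩, huniq⟩ := existsUnique_closing (π := π) haT
          have hnotP : ∀ j, SameBlock π a j → j ∉ P := fun j hj hjP =>
            hat_block (hj.trans (hone j hjP))
          refine ⟨z, ⟨?_, haz, hcl⟩, fun y hy => huniq y ⟨hy.2.1.right_mem, hy.2⟩⟩
          obtain ⟨j, hja, haj⟩ := exists_ne_sameBlock hns haT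
          -- As the block of `a` does not meet `P`, its other elements are larger than `a`.
          have hmem : ∀ i, SameBlock π a i → i = a ∨ i ∈ S := by
            intro i hi
            have hiT := hi.right_mem
            rw [← hT] at hiT
            simp only [Finset.mem_union, Finset.mem_insert] at hiT
            rcases hiT with h | rfl | h
            · exact (hnotP i hi h).elim
            · exact (hat_block hi).elim
            · exact h
          refine (hmem z haz).resolve_left fun hza => ?_
          have h1 := ha j ((hmem j haj).resolve_left hja)
          have h2 := (isClosing_iff.1 hcl).2 j (haz.symm.trans haj)
          omega

theorem ip_single (x y : B) : D.ip (single x) (single y) = D.φ (star y * x) := by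
  rw [single, single, ip_tens]; rfl

end Data

theorem Icc_one_eq {n : ℕ} (hn : 2 ≤ n) :
    Finset.Icc 1 n = insert 1 (insert n (Finset.Ioo 1 n)) := by
  ext i
  simp only [Finset.mem_Icc, Finset.mem_insert, Finset.mem_Ioo]
  omega

theorem ncTildeNs_eq (n : ℕ) :
    ncTildeNs n = outerPartitions (Finset.Icc 1 n) {1} n := by
  ext π
  rw [mem_outerPartitions]
  simp [ncTildeNs]

/-- The weight `W'(π)`, with the exceptional operator at `1` split off. -/
theorem Data.weightPrime_eq {B : Type*} [Ring B] [StarRing B] [Algebra ℂ B] [StarModule ℂ B]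
    (D : Data B) (u : ℕ → B) {n : ℕ} (hn : 2 ≤ n) {π : Finpartition (Finset.Icc 1 n)}
    (hπ : SameBlock π 1 n) :
    D.weightPrime u π = firstSlot (LinearMap.mulLeft ℂ (u 1))
      * orderedProd (insert n (Finset.Ioo 1 n)) (D.typeOp u π) := by
  have hlt : ∀ s ∈ insert n (Finset.Ioo 1 n), 1 < s := by
    intro s hs
    simp only [Finset.mem_insert, Finset.mem_Ioo] at hs
    omega
  have hcl : ¬IsClosing π 1 := fun h => absurd ((isClosing_iff.1 h).2 n hπ) (by omega)
  have key : ∀ (S : Finset ℕ), S = insert 1 (insert n (Finset.Ioo 1 n)) →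
      ∀ f : ℕ → Module.End ℂ (Fock B),
        orderedProd S f = f 1 * orderedProd (insert n (Finset.Ioo 1 n)) f := by
    rintro _ rfl f
    exact orderedProd_insert hlt f
  rw [weightPrime, key _ (Icc_one_eq hn)]
  congr 1
  · rw [if_neg hcl, if_pos rfl]
  · refine orderedProd_congr fun i hi => ?_
    rw [if_neg (hlt i hi).ne']
    rfl

end NNFock

end

theorem mainTheorem3 {B : Type*} [Ring B] [StarRing B] [Algebra ℂ B] [StarModule ℂ B]
    (D : NNFock.Data B) (n : ℕ) (hn : 2 ≤ n) (u : ℕ → B) :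
    NNFock.freeCumulant D.vacuumState (fun i => D.X (u i)) (Finset.Icc 1 n) =
        D.ip (NNFock.single (D.Rprime u (Finset.Ioo 1 n) (u n))) (NNFock.single (star (u 1))) ∧
      D.ip (NNFock.single (D.Rprime u (Finset.Ioo 1 n) (u n))) (NNFock.single (star (u 1))) =
        D.φ (u 1 * D.Rprime u (Finset.Ioo 1 n) (u n)) ∧
      NNFock.single (u 1 * D.Rprime u (Finset.Ioo 1 n) (u n)) =
        ∑ π ∈ NNFock.ncTildeNs n, D.weightPrime u π (NNFock.vacuum B) := by
  have hip : D.ip (NNFock.single (D.Rprime u (Finset.Ioo 1 n) (u n)))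
      (NNFock.single (star (u 1))) = D.φ (u 1 * D.Rprime u (Finset.Ioo 1 n) (u n)) := by
    rw [D.ip_single, star_star]
  have h1n : 1 < n := by omega
  refine ⟨?_, hip, ?_⟩
  · rw [hip, D.freeCumulant_X u (Finset.nonempty_Icc.2 h1n.le), NNFock.Icc_one_eq hn,
      D.cumulantValue_insert u h1n fun p hp => Finset.mem_Ioo.1 hp]
  · have h : ∀ π ∈ NNFock.outerPartitions (Finset.Icc 1 n) {1} n,
        D.weightPrime u π (NNFock.vacuum B) = NNFock.firstSlot (LinearMap.mulLeft ℂ (u 1))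
          (NNFock.orderedProd (insert n (Finset.Ioo 1 n)) (D.typeOp u π) (NNFock.vacuum B)) := by
      intro π hπ
      have h1 := (NNFock.mem_outerPartitions.1 hπ).2.1 1 (Finset.mem_singleton_self 1)
      rw [D.weightPrime_eq u hn h1, Module.End.mul_apply]
    rw [NNFock.ncTildeNs_eq, Finset.sum_congr rfl h, ← map_sum,
      D.sum_outerPartitions u (by rw [NNFock.Icc_one_eq hn]; rfl) (Finset.singleton_nonempty 1)
        (by simpa using h1n) (by simpa using fun s hs _ => hs)
        (fun s hs => (Finset.mem_Ioo.1 hs).2),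
      NNFock.firstSlot_aPlus, NNFock.aPlus_vacuum, LinearMap.mulLeft_apply]
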